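/- Let $M$ be a smooth (Hausdorff, boundaryless) Riemannian manifold of dimension $n\ge 2$ with metric $(\cdot\,|\,\cdot)$, Levi-Civita connection $\nabla$ and curvature tensor $\mathbf R$, where $\mathbf R(\mathbf X,\mathbf Y)=[\nabla_{\mathbf X},\nabla_{\mathbf Y}]-\nabla_{[\mathbf X,\mathbf Y]}$. Let $\mathbf F$ be a smooth force field, that is, a smooth fibre-preserving map $TM\to TM$, $(p,\mathbf v)\mapsto(p,\mathbf F(p,\mathbf v))$. A trajectory of the Newtonian dynamical system with force field $\mathbf F$ is a smooth curve on an open interval which in local coordinates satisfies $$\dot x^k=v^k,\qquad \nabla_t v^k=F^k(x,v).$$ A vector of variation on a trajectory is a smooth vector field $\boldsymbol\tau(t)$ along it with $$\nabla_{t}\nabla_t\tau^k=-\sum_{m,i,j} R^k_{mij}\,\tau^i v^j v^m+\sum_m \nabla_t\tau^m\,\tilde\nabla_m F^k+\sum_m\tau^m\,\nabla_m F^k,$$ where $\tilde\nabla_mF^k=\partial F^k/\partial v^m$, $\nabla_mF^k=\partial F^k/\partial x^m+\sum_i\Gamma^k_{mi}F^i-\sum_{i,j}\Gamma^i_{mj}v^j\,\partial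 F^k/\partial v^i$ and $(\mathbf R(\mathbf X,\mathbf Y)\mathbf Z)^k=\sum R^k_{mij}Z^mX^iY^j$. The corresponding function of deviation is $\varphi=(\mathbf v\,|\,\boldsymbol\tau)$. A hypersurface is a smooth embedded submanifold of codimension $1$ without boundary. It is of transformation class if it is connected, simply connected, and has compact closure contained in some hypersurface $S''$. A function $\nu$ on such a hypersurface $S$ is of transformation class if it extends smoothly to some hypersurface containing $\overline S$ and is nonzero everywhere on $\overline S$. Given a smooth field $\mathbf n$ of unit normal vectors and a function $\nu$ of transformation class on a hypersurface $S$ of transformation class, the shift $f_t\colon S\to S_t$ ($|t|<\varepsilon$, with $\varepsilon>0$ so small that $(p,t)\mapsto f_t(p)$ is defined on $S\times(-\varepsilon,\varepsilon)$, smooth, injective and without singular points) sends $p\in S$ to the point at time $t$ of the trajectory starting at $p$ with velocity $\nu(p)\,\mathbf n(p)$. Local coordinates $u^1,\dots,u^{n-1}$ on $S$ give vectors of variation $\boldsymbol\tau_k=\partial f_t/\partial u^k$ and functions of deviation $\varphi_k=(\boldsymbol\tau_k\,|\,\mathbf v)$. The shift is normal if, for some such $\varepsilon$, all $S_t$ with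 $|t|<\varepsilon$ are orthogonal to the trajectories of the shift. Consider the following conditions. * Weak normality: for every trajectory there are continuous functions $\mathcal A(t),\mathcal B(t)$ on its time interval such that every function of deviation on this trajectory satisfies $\ddot\varphi=\mathcal A(t)\,\dot\varphi+\mathcal B(t)\,\varphi$. * Additional normality: for every hypersurface $S$, every $p_0\in S$, each choice of unit normal vector at $p_0$ and every real $\nu_0\ne0$ there are a relatively open piece $S'\ni p_0$ of $S$ of transformation class, with the smooth field $\mathbf n$ of unit normals extending the chosen one, and a function $\nu$ of transformation class on $S'$ with $\nu(p_0)=\nu_0$, such that the shift of $S'$ defined by $\mathbf n$ and $\nu$ satisfies $\dot\varphi_k|_{t=0}=0$ for $k=1,\dots,n-1$ everywhere on $S'$. * Complete normality: weak normality and additional normality together. * Strong normality (the system admits the normal shift): for every hypersurface $S$, every $p_0\in S$, each choice of unit normal vector at $p_0$ and every real $\nu_0\ne0$ there are $S'$, $\mathbf n$ and $\nu$ as above with $\nu(p_0)=\nu_0$ such that the shift of $S'$ defined by $\mathbf n$ and $\nu$ is a normal shift. Theorem. The system satisfies the complete normality condition if and only if it satisfies the strong normality condition. -/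

import Mathlib

open Set
open scoped Manifold ContDiff

noncomputable section

namespace NewtonianShift

/-! ### Local coordinates on a Riemannian manifold

All local coordinates are taken with respect to an arbitrary smooth chart `e` (a chart of the maximal
smooth atlas). `y` is a point of `ℝⁿ` in the target of `e`, and `w` is the list of components of a
velocity vector. -/

/-- The `i`-th vector of the standard basis of `ℝⁿ`. -/
def stdVec {n : ℕ} (i : Fin n) : EuclideanSpace ℝ (Fin n) := EuclideanSpace.single i (1 : ℝ)

/-- The partial derivative `∂h/∂yⁱ` at the point `y`. -/
def partialDeriv {n : ℕ} (i : Fin n) (h : EuclideanSpace ℝ (Fin n) → ℝ)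
    (y : EuclideanSpace ℝ (Fin n)) : ℝ :=
  fderiv ℝ h y (stdVec i)

section Tensors

variable {n : ℕ} {M : Type*} [TopologicalSpace M] [ChartedSpace (EuclideanSpace ℝ (Fin n)) M]

/-- The tangent vector at the point with coordinates `y` whose components are `w`. -/
def vecOfCoord (e : OpenPartialHomeomorph M (EuclideanSpace ℝ (Fin n)))
    (y w : EuclideanSpace ℝ (Fin n)) : TangentSpace (𝓡 n) (e.symm y) :=
  mfderiv (𝓡 n) (𝓡 n) e.symm y w

/-- The components of the tangent vector `w` at the point `p`. -/
def coordOfVec (e : OpenPartialHomeomorph M (EuclideanSpace ℝ (Fin n)))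
    (p : M) (w : TangentSpace (𝓡 n) p) : EuclideanSpace ℝ (Fin n) :=
  mfderiv (𝓡 n) (𝓡 n) e p w

variable [IsManifold (𝓡 n) ∞ M]
  (g : Bundle.ContMDiffRiemannianMetric (𝓡 n) ∞ (EuclideanSpace ℝ (Fin n))
    (fun p : M => TangentSpace (𝓡 n) p))
  (F : ∀ p : M, TangentSpace (𝓡 n) p → TangentSpace (𝓡 n) p)
  (e : OpenPartialHomeomorph M (EuclideanSpace ℝ (Fin n)))

/-- The matrix `g_{ij}` of the metric. -/
def metricMatrix (y : EuclideanSpace ℝ (Fin n)) : Matrix (Fin n) (Fin n) ℝ :=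
  Matrix.of fun i j =>
    g.inner (e.symm y) (vecOfCoord e y (stdVec i)) (vecOfCoord e y (stdVec j))

/-- The components `Γ^k_{ij}` of the metric (Levi-Civita) connection. -/
def christoffel (k i j : Fin n) (y : EuclideanSpace ℝ (Fin n)) : ℝ :=
  (1 / 2) * ∑ s, (metricMatrix g e y)⁻¹ k s *
    (partialDeriv i (fun z => metricMatrix g e z s j) y
      + partialDeriv j (fun z => metricMatrix g e z i s) y
      - partialDeriv s (fun z => metricMatrix g e z i j) y)

/-- The components `R^k_{mij}` of the curvature tensor, with the convention
`(R(X, Y) Z)^k = ∑ R^k_{mij} Z^m X^i Y^j`, `R(X, Y) = [∇_X, ∇_Y] - ∇_{[X, Y]}`. -/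
def riemann (k m i j : Fin n) (y : EuclideanSpace ℝ (Fin n)) : ℝ :=
  partialDeriv i (christoffel g e k j m) y - partialDeriv j (christoffel g e k i m) y
    + ∑ a, (christoffel g e k i a y * christoffel g e a j m y
      - christoffel g e k j a y * christoffel g e a i m y)

/-- The components `F^k(y, w)` of the force field. -/
def forceCoord (k : Fin n) (y w : EuclideanSpace ℝ (Fin n)) : ℝ :=
  coordOfVec e (e.symm y) (F (e.symm y) (vecOfCoord e y w)) k

/-- The velocity gradient `∇̃_m F^k = ∂F^k/∂v^m`. -/
def velocityGrad (m k : Fin n) (y w : EuclideanSpace ℝ (Fin n)) : ℝ :=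
  partialDeriv m (fun w' => forceCoord F e k y w') w

/-- The space gradient of the force field, as an extended vector field:
`∇_m F^k = ∂F^k/∂x^m + ∑ Γ^k_{mi} F^i - ∑ Γ^i_{mj} v^j ∂F^k/∂v^i`. -/
def spaceGrad (m k : Fin n) (y w : EuclideanSpace ℝ (Fin n)) : ℝ :=
  partialDeriv m (fun y' => forceCoord F e k y' w) y
    + ∑ i, christoffel g e k m i y * forceCoord F e i y w
    - ∑ i, ∑ j, christoffel g e i m j y * w j * velocityGrad F e i k y w

/-- The components `∇_t V^k = dV^k/dt + ∑ Γ^k_{ij} (dx^i/dt) V^j` of the covariant derivative of a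
vector field with components `V` along the curve with coordinates `x`. -/
def covDerivAlong (x V : ℝ → EuclideanSpace ℝ (Fin n)) (t : ℝ) : EuclideanSpace ℝ (Fin n) :=
  WithLp.toLp 2 fun k =>
    deriv V t k + ∑ i, ∑ j, christoffel g e k i j (x t) * deriv x t i * V t j

end Tensors

/-! ### Trajectories, vectors of variation, functions of deviation, weak normality -/

section Dynamics

variable {n : ℕ} {M : Type*} [TopologicalSpace M] [ChartedSpace (EuclideanSpace ℝ (Fin n)) M]

/-- The velocity vector of a curve. -/
def velocity (γ : ℝ → M) (t : ℝ) : TangentSpace (𝓡 n) (γ t) :=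
  mfderiv 𝓘(ℝ, ℝ) (𝓡 n) γ t (1 : ℝ)

variable [IsManifold (𝓡 n) ∞ M]
  (g : Bundle.ContMDiffRiemannianMetric (𝓡 n) ∞ (EuclideanSpace ℝ (Fin n))
    (fun p : M => TangentSpace (𝓡 n) p))
  (F : ∀ p : M, TangentSpace (𝓡 n) p → TangentSpace (𝓡 n) p)

/-- `γ` restricted to the open interval `J` is a trajectory of the Newtonian dynamical system with
force field `F`: in every local chart `dx^k/dt = v^k`, `∇_t v^k = F^k(x, v)`. -/
structure IsTrajectory (J : Set ℝ) (γ : ℝ → M) : Prop where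
  isOpen : IsOpen J
  ordConnected : J.OrdConnected
  smooth : ContMDiffOn 𝓘(ℝ, ℝ) (𝓡 n) ∞ γ J
  newton : ∀ e ∈ IsManifold.maximalAtlas (𝓡 n) ∞ M, ∀ t ∈ J, γ t ∈ e.source →
    ∀ k, covDerivAlong g e (fun s => e (γ s)) (deriv fun s => e (γ s)) t k
      = forceCoord F e k (e (γ t)) (deriv (fun s => e (γ s)) t)

/-- `τ` is a vector of variation on the trajectory `γ`: a vector field along `γ` which satisfies
`∇_t ∇_t τ = C(∇_t τ ⊗ ∇̃F) + C(τ ⊗ ∇F) - R(τ, v) v`, written in every local chart. -/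
structure IsVariation (J : Set ℝ) (γ : ℝ → M) (τ : ∀ t, TangentSpace (𝓡 n) (γ t)) : Prop where
  smooth : ContMDiffOn 𝓘(ℝ, ℝ) (𝓡 n).tangent ∞
    (fun t => (⟨γ t, τ t⟩ : TangentBundle (𝓡 n) M)) J
  equation : ∀ e ∈ IsManifold.maximalAtlas (𝓡 n) ∞ M, ∀ t ∈ J, γ t ∈ e.source →
    let x : ℝ → EuclideanSpace ℝ (Fin n) := fun s => e (γ s)
    let v : ℝ → EuclideanSpace ℝ (Fin n) := deriv x
    let T : ℝ → EuclideanSpace ℝ (Fin n) := fun s => coordOfVec e (γ s) (τ s)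
    let DT : ℝ → EuclideanSpace ℝ (Fin n) := covDerivAlong g e x T
    ∀ k, covDerivAlong g e x DT t k =
      - (∑ m, ∑ i, ∑ j, riemann g e k m i j (x t) * T t i * v t j * v t m)
      + ∑ m, DT t m * velocityGrad F e m k (x t) (v t)
      + ∑ m, T t m * spaceGrad g F e m k (x t) (v t)

/-- The function of deviation `φ = (v | τ)`. -/
def deviation (γ : ℝ → M) (τ : ∀ t, TangentSpace (𝓡 n) (γ t)) (t : ℝ) : ℝ :=
  g.inner (γ t) (velocity γ t) (τ t)

/-- Weak normality: on each trajectory all functions of deviation satisfy one and the same equation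
`φ'' = A(t) φ' + B(t) φ`. -/
def WeakNormality : Prop :=
  ∀ (J : Set ℝ) (γ : ℝ → M), IsTrajectory g F J γ →
    ∃ A B : ℝ → ℝ, ContinuousOn A J ∧ ContinuousOn B J ∧
      ∀ τ : (∀ t, TangentSpace (𝓡 n) (γ t)), IsVariation g F J γ τ →
        ∀ t ∈ J, deriv (deriv (deviation g γ τ)) t
          = A t * deriv (deviation g γ τ) t + B t * deviation g γ τ t

end Dynamics

/-! ### Hypersurfaces -/

section Hypersurfaces

variable {n : ℕ} {M : Type*} [TopologicalSpace M] [ChartedSpace (EuclideanSpace ℝ (Fin n)) M]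

/-- `X`, defined on the open set `W` of `ℝⁿ⁻¹`, is a local parametrization of `S` (the inverse of a
system of local coordinates `u¹, …, uⁿ⁻¹` on `S`): a smooth immersion which is a homeomorphism of `W`
onto a relatively open subset of `S`. -/
structure IsLocalParam (S : Set M) (W : Set (EuclideanSpace ℝ (Fin (n - 1))))
    (X : EuclideanSpace ℝ (Fin (n - 1)) → M) : Prop where
  isOpen : IsOpen W
  smooth : ContMDiffOn (𝓡 (n - 1)) (𝓡 n) ∞ X W
  immersive : ∀ u ∈ W, Function.Injective (mfderiv (𝓡 (n - 1)) (𝓡 n) X u)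
  injOn : InjOn X W
  isOpen_image : ∀ W' ⊆ W, IsOpen W' → ∃ U : Set M, IsOpen U ∧ X '' W' = S ∩ U

/-- `S` is an (embedded, smooth, boundaryless) hypersurface in the `n`-dimensional manifold `M`. -/
def IsHypersurface (S : Set M) : Prop :=
  ∀ p ∈ S, ∃ (W : Set (EuclideanSpace ℝ (Fin (n - 1)))) (X : EuclideanSpace ℝ (Fin (n - 1)) → M),
    IsLocalParam S W X ∧ p ∈ X '' W

/-- Hypersurfaces of transformation class. -/
structure IsTransformationClass (S : Set M) : Prop where
  hypersurface : IsHypersurface (n := n) S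
  connected : IsConnected S
  simplyConnected : SimplyConnectedSpace S
  compact_closure : IsCompact (closure S)
  exists_bigger : ∃ S' : Set M, IsHypersurface (n := n) S' ∧ closure S ⊆ S'

/-- A function `ν` of transformation class on `S`: it is smooth on some hypersurface `S'` with
`S ⋐ S'`, and it is nonzero everywhere on the closure of `S`. -/
def IsTransformationClassFun (S : Set M) (ν : M → ℝ) : Prop :=
  (∃ S' : Set M, IsHypersurface (n := n) S' ∧ closure S ⊆ S' ∧
    ∀ (W : Set (EuclideanSpace ℝ (Fin (n - 1)))) (X : EuclideanSpace ℝ (Fin (n - 1)) → M),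
      IsLocalParam S' W X → ContMDiffOn (𝓡 (n - 1)) 𝓘(ℝ, ℝ) ∞ (fun u => ν (X u)) W) ∧
  ∀ p ∈ closure S, ν p ≠ 0

/-- `w` is tangent to the hypersurface `S` at the point `p`. -/
def IsTangentTo (S : Set M) (p : M) (w : TangentSpace (𝓡 n) p) : Prop :=
  ∃ (W : Set (EuclideanSpace ℝ (Fin (n - 1)))) (X : EuclideanSpace ℝ (Fin (n - 1)) → M),
    IsLocalParam S W X ∧ ∃ u ∈ W, ∃ a : EuclideanSpace ℝ (Fin (n - 1)),
      (⟨p, w⟩ : TangentBundle (𝓡 n) M) = ⟨X u, mfderiv (𝓡 (n - 1)) (𝓡 n) X u a⟩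

variable [IsManifold (𝓡 n) ∞ M]
  (g : Bundle.ContMDiffRiemannianMetric (𝓡 n) ∞ (EuclideanSpace ℝ (Fin n))
    (fun p : M => TangentSpace (𝓡 n) p))
  (F : ∀ p : M, TangentSpace (𝓡 n) p → TangentSpace (𝓡 n) p)

/-- `m` is a unit normal vector to `S` at the point `p`. -/
def IsUnitNormalAt (S : Set M) (p : M) (m : TangentSpace (𝓡 n) p) : Prop :=
  g.inner p m m = 1 ∧ ∀ w : TangentSpace (𝓡 n) p, IsTangentTo S p w → g.inner p m w = 0

/-- `N` is a smooth field of unit normal vectors on the hypersurface `S`. -/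
structure IsUnitNormalField (S : Set M) (N : ∀ p : M, TangentSpace (𝓡 n) p) : Prop where
  unitNormal : ∀ p ∈ S, IsUnitNormalAt g S p (N p)
  smooth : ∀ (W : Set (EuclideanSpace ℝ (Fin (n - 1)))) (X : EuclideanSpace ℝ (Fin (n - 1)) → M),
    IsLocalParam S W X → ContMDiffOn (𝓡 (n - 1)) (𝓡 n).tangent ∞
      (fun u => (⟨X u, N (X u)⟩ : TangentBundle (𝓡 n) M)) W

/-- `f` is the shift of the hypersurface `S`, for `t ∈ (-ε, ε)`, along the trajectories of the system
that start at `t = 0` from the points `p ∈ S` with velocity `ν(p) N(p)`. The map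
`S × (-ε, ε) → M`, `(p, t) ↦ f p t`, is smooth, injective and has no singular points, so that
`S_t = {f p t | p ∈ S}` are disjoint hypersurfaces diffeomorphic to `S`. -/
structure IsShift (S : Set M) (N : ∀ p : M, TangentSpace (𝓡 n) p) (ν : M → ℝ) (ε : ℝ)
    (f : M → ℝ → M) : Prop where
  pos : 0 < ε
  trajectory : ∀ p ∈ S, IsTrajectory g F (Ioo (-ε) ε) (f p)
  initial : ∀ p ∈ S,
    (⟨f p 0, velocity (f p) 0⟩ : TangentBundle (𝓡 n) M) = ⟨p, ν p • N p⟩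
  injective : ∀ p ∈ S, ∀ q ∈ S, ∀ s ∈ Ioo (-ε) ε, ∀ t ∈ Ioo (-ε) ε, f p s = f q t → p = q ∧ s = t
  smooth : ∀ (W : Set (EuclideanSpace ℝ (Fin (n - 1)))) (X : EuclideanSpace ℝ (Fin (n - 1)) → M),
    IsLocalParam S W X → ContMDiffOn ((𝓡 (n - 1)).prod 𝓘(ℝ, ℝ)) (𝓡 n) ∞
      (fun q : EuclideanSpace ℝ (Fin (n - 1)) × ℝ => f (X q.1) q.2) (W ×ˢ Ioo (-ε) ε)
  nonsingular : ∀ (W : Set (EuclideanSpace ℝ (Fin (n - 1))))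
    (X : EuclideanSpace ℝ (Fin (n - 1)) → M), IsLocalParam S W X →
    ∀ q ∈ W ×ˢ Ioo (-ε) ε, Function.Bijective (mfderiv ((𝓡 (n - 1)).prod 𝓘(ℝ, ℝ)) (𝓡 n)
      (fun q : EuclideanSpace ℝ (Fin (n - 1)) × ℝ => f (X q.1) q.2) q)

/-- The vector of variation `τ_k = ∂x/∂u^k` on the trajectory of shift starting at `X u`. -/
def shiftVariation (f : M → ℝ → M) (X : EuclideanSpace ℝ (Fin (n - 1)) → M)
    (u : EuclideanSpace ℝ (Fin (n - 1))) (k : Fin (n - 1)) (t : ℝ) :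
    TangentSpace (𝓡 n) (f (X u) t) :=
  mfderiv (𝓡 (n - 1)) (𝓡 n) (fun u' => f (X u') t) u (stdVec k)

/-- The function of deviation `φ_k = (τ_k | v)` on the trajectory of shift starting at `X u`. -/
def shiftDeviation (f : M → ℝ → M) (X : EuclideanSpace ℝ (Fin (n - 1)) → M)
    (u : EuclideanSpace ℝ (Fin (n - 1))) (k : Fin (n - 1)) : ℝ → ℝ :=
  deviation g (f (X u)) (shiftVariation f X u k)

/-- The shift `f` of `S` is normal on the time interval `(-ε, ε)`: every `S_t` is orthogonal to the
trajectories of shift. The tangent spaces of `S_t` are spanned by the vectors `τ_k`. -/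
def IsNormalShift (S : Set M) (ε : ℝ) (f : M → ℝ → M) : Prop :=
  ∀ (W : Set (EuclideanSpace ℝ (Fin (n - 1)))) (X : EuclideanSpace ℝ (Fin (n - 1)) → M),
    IsLocalParam S W X → ∀ u ∈ W, ∀ t ∈ Ioo (-ε) ε, ∀ k,
      g.inner (f (X u) t) (velocity (f (X u)) t) (shiftVariation f X u k t) = 0

/-- Additional normality: for every hypersurface `S`, point `p₀ ∈ S`, choice `m₀` of the unit normal
vector at `p₀` and number `ν₀ ≠ 0`, a piece `S'` of `S` around `p₀` can be shifted, with initial speed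
`ν` normalized by `ν(p₀) = ν₀`, so that the first derivatives of all functions of deviation vanish
at `t = 0`. -/
def AdditionalNormality : Prop :=
  ∀ S : Set M, IsHypersurface (n := n) S → ∀ p₀ ∈ S,
    ∀ m₀ : TangentSpace (𝓡 n) p₀, IsUnitNormalAt g S p₀ m₀ → ∀ ν₀ : ℝ, ν₀ ≠ 0 →
    ∃ S' : Set M, (∃ U : Set M, IsOpen U ∧ S' = S ∩ U) ∧ p₀ ∈ S' ∧
      IsTransformationClass (n := n) S' ∧
    ∃ N : (∀ p : M, TangentSpace (𝓡 n) p), IsUnitNormalField g S' N ∧ N p₀ = m₀ ∧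
    ∃ ν : M → ℝ, IsTransformationClassFun (n := n) S' ν ∧ ν p₀ = ν₀ ∧
    ∃ (ε : ℝ) (f : M → ℝ → M), IsShift g F S' N ν ε f ∧
      ∀ (W : Set (EuclideanSpace ℝ (Fin (n - 1)))) (X : EuclideanSpace ℝ (Fin (n - 1)) → M),
        IsLocalParam S' W X → ∀ u ∈ W, ∀ k, deriv (shiftDeviation g f X u k) 0 = 0

/-- Strong normality: the system admits the normal shift. -/
def StrongNormality : Prop :=
  ∀ S : Set M, IsHypersurface (n := n) S → ∀ p₀ ∈ S,
    ∀ m₀ : TangentSpace (𝓡 n) p₀, IsUnitNormalAt g S p₀ m₀ → ∀ ν₀ : ℝ, ν₀ ≠ 0 →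
    ∃ S' : Set M, (∃ U : Set M, IsOpen U ∧ S' = S ∩ U) ∧ p₀ ∈ S' ∧
      IsTransformationClass (n := n) S' ∧
    ∃ N : (∀ p : M, TangentSpace (𝓡 n) p), IsUnitNormalField g S' N ∧ N p₀ = m₀ ∧
    ∃ ν : M → ℝ, IsTransformationClassFun (n := n) S' ν ∧ ν p₀ = ν₀ ∧
    ∃ (ε : ℝ) (f : M → ℝ → M), IsShift g F S' N ν ε f ∧ IsNormalShift g S' ε f

/-- Complete normality. -/
def CompleteNormality : Prop := WeakNormality g F ∧ AdditionalNormality g F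

end Hypersurfaces

end NewtonianShift

end

/-! Along a trajectory put `w = ∇_t τ`. The metric is parallel and the equation of variations has
second order, so `φ`, `φ'` and `φ''` at one instant are linear functions of the Cauchy data `(τ,
w)`, with coefficients depending only on position and velocity (`deviationDeriv`,
`deviationDeriv2`). Off the zero section, weak normality is therefore encoded by a pointwise
algebraic condition, `IsPointwiseNormal`: `φ''` vanishes on the common kernel of `φ` and `φ'`, and
so is a linear combination of them.

Complete implies strong. The fields `∂f_t/∂u^k` of a shift are vectors of variation
(`cov_cov_eq_variationRhs`, `IsShift.isVariation`). Their functions of deviation vanish at `t = 0`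
because the initial velocity is normal to the hypersurface, and additional normality makes their
first derivatives vanish there too. Weak normality supplies a linear homogeneous equation of second
order, so these functions vanish identically (`eq_zero_of_linear_ode2`).

Strong implies additional: a function that is identically zero has zero derivative.

Strong implies weak. Fix a point, a velocity `v ≠ 0` and Cauchy data `(T, w)` with `φ = φ' = 0` and
`T ≠ 0`. A hypersurface through the point, orthogonal to `v`, may have any second fundamental form,
and this form governs the tangential part of `∇_t τ` for its normal shift; the normal part is fixed
by `φ' = 0`. A quadric can thus be chosen whose normal shift has exactly the data `(T, w)`, and `φ ≡
0` for this shift gives `φ'' = 0` (`StrongNormality.deviationDeriv2_eq_zero`). The case `T = 0`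
follows by linearity, which gives `IsPointwiseNormal`.

The resulting coefficients are continuous only where `v ≠ 0`. Letting `v → 0` in the pointwise
condition, however, shows that the force vanishes on the zero section when `n ≥ 2`
(`IsPointwiseNormal.force_zero`). A trajectory with zero velocity at some instant is then constant
near it, all its functions of deviation vanish there, and any coefficients will do. The admissible
pairs `(A, B)` at an instant form a convex set, so the local choices are glued by a partition of
unity. -/

set_option maxSynthPendingDepth 3

noncomputable section

namespace NewtonianShift

open Filter Topology

/-! ### Newtonian dynamics in an open subset of a normed space -/

section LocalTheory

variable {E : Type*} [NormedAddCommGroup E] [NormedSpace ℝ E]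
  {E' : Type*} [NormedAddCommGroup E'] [NormedSpace ℝ E']
  {P : Type*} [NormedAddCommGroup P] [NormedSpace ℝ P]

/-- A metric `G`, its Levi-Civita connection `Γ` and a force `Φ` in a domain `D`. -/
structure IsLocalSystem (D : Set E) (G : E → E →L[ℝ] E →L[ℝ] ℝ) (Γ : E → E →L[ℝ] E →L[ℝ] E)
    (Φ : E × E → E) : Prop where
  isOpen : IsOpen D
  smooth_metric : ContDiffOn ℝ ∞ G D
  metric_symm : ∀ y ∈ D, ∀ a b, G y a b = G y b a
  metric_pos : ∀ y ∈ D, ∀ a, a ≠ 0 → 0 < G y a a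
  smooth_connection : ContDiffOn ℝ ∞ Γ D
  connection_symm : ∀ y ∈ D, ∀ a b, Γ y a b = Γ y b a
  metric_compat : ∀ y ∈ D, ∀ a b c,
    fderiv ℝ G y a b c = G y (Γ y a b) c + G y b (Γ y a c)
  smooth_force : ContDiffOn ℝ ∞ Φ (D ×ˢ univ)

/-- The covariant derivative of the field `V` along the curve `x`. -/
def cov (Γ : E → E →L[ℝ] E →L[ℝ] E) (x V : ℝ → E) (t : ℝ) : E :=
  deriv V t + Γ (x t) (deriv x t) (V t)

/-- The curvature of the connection `Γ`. -/
def curv (Γ : E → E →L[ℝ] E →L[ℝ] E) (y a b c : E) : E :=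
  fderiv ℝ Γ y a b c - fderiv ℝ Γ y b a c + (Γ y a (Γ y b c) - Γ y b (Γ y a c))

/-- The right-hand side of the equation of variations. -/
def variationRhs (Γ : E → E →L[ℝ] E →L[ℝ] E) (Φ : E × E → E) (y v T w : E) : E :=
  -curv Γ y T v v + fderiv ℝ Φ (y, v) (0, w)
    + (fderiv ℝ Φ (y, v) (T, 0) + Γ y T (Φ (y, v)) - fderiv ℝ Φ (y, v) (0, Γ y T v))

/-- The covariant derivative of the force along a trajectory. -/
def forceDeriv (Γ : E → E →L[ℝ] E →L[ℝ] E) (Φ : E × E → E) (y v : E) : E :=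
  fderiv ℝ Φ (y, v) (v, Φ (y, v) - Γ y v v) + Γ y v (Φ (y, v))

/-- The first derivative of the function of deviation as a function of `T` and `w = ∇_t T`. -/
def deviationDeriv (G : E → E →L[ℝ] E →L[ℝ] ℝ) (Φ : E × E → E) (y v T w : E) : ℝ :=
  G y (Φ (y, v)) T + G y v w

/-- The second derivative of the function of deviation as a function of `T` and `w = ∇_t T`. -/
def deviationDeriv2 (G : E → E →L[ℝ] E →L[ℝ] ℝ) (Γ : E → E →L[ℝ] E →L[ℝ] E) (Φ : E × E → E)
    (y v T w : E) : ℝ :=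
  G y (forceDeriv Γ Φ y v) T + 2 * G y (Φ (y, v)) w + G y v (variationRhs Γ Φ y v T w)

theorem hasDerivAt_bilinear_along {B : E → E →L[ℝ] E →L[ℝ] E'} {x V W : ℝ → E} {x' V' W' : E}
    {t : ℝ} (hB : DifferentiableAt ℝ B (x t)) (hx : HasDerivAt x x' t) (hV : HasDerivAt V V' t)
    (hW : HasDerivAt W W' t) :
    HasDerivAt (fun s => B (x s) (V s) (W s))
      (fderiv ℝ B (x t) x' (V t) (W t) + B (x t) V' (W t) + B (x t) (V t) W') t := by
  have h1 : HasDerivAt (fun s => B (x s)) (fderiv ℝ B (x t) x') t :=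
    HasFDerivAt.comp_hasDerivAt (F := E) (E := E →L[ℝ] E →L[ℝ] E') (l := B) (f := x) t
      hB.hasFDerivAt hx
  simpa [add_assoc] using (h1.clm_apply hV).clm_apply hW

theorem hasDerivAt_slice {H : P × ℝ → E} {H' : P × ℝ →L[ℝ] E} {u : P} {t : ℝ}
    (h : HasFDerivAt H H' (u, t)) : HasDerivAt (fun s => H (u, s)) (H' (0, 1)) t :=
  HasFDerivAt.comp_hasDerivAt (f := fun s : ℝ => (u, s)) t h
    ((hasDerivAt_const t u).prodMk (hasDerivAt_id t))

theorem hasDerivAt_line {H : P × ℝ → E} {H' : P × ℝ →L[ℝ] E} {u : P} {t : ℝ} (α : P)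
    (h : HasFDerivAt H H' (u, t)) : HasDerivAt (fun s : ℝ => H (u + s • α, t)) (H' (α, 0)) 0 := by
  have h1 : HasDerivAt (fun s : ℝ => u + s • α) α 0 := by
    simpa using ((hasDerivAt_id (0 : ℝ)).smul_const α).const_add u
  refine HasFDerivAt.comp_hasDerivAt (f := fun s : ℝ => (u + s • α, t)) 0 ?_
    (h1.prodMk (hasDerivAt_const 0 t))
  simpa using h

theorem eventually_slice {P : Type*} [TopologicalSpace P] {O : Set (P × ℝ)} (hO : IsOpen O) {u : P} {t : ℝ} (h : (u, t) ∈ O) :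
    ∀ᶠ s in 𝓝 t, (u, s) ∈ O :=
  (by fun_prop : Continuous fun s : ℝ => (u, s)).continuousAt.eventually (hO.mem_nhds h)

theorem eventually_line {O : Set (P × ℝ)} (hO : IsOpen O) {u : P} {t : ℝ} (h : (u, t) ∈ O)
    (α : P) : ∀ᶠ s in 𝓝 (0 : ℝ), (u + s • α, t) ∈ O :=
  (by fun_prop : Continuous fun s : ℝ => (u + s • α, t)).continuousAt.eventually
    (hO.mem_nhds (by simpa using h))

/-- Symmetry of the second derivative. Combined with the symmetry of `Γ`, it lets `∇_t` and the
derivative in the parameter be interchanged on a family of curves. -/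
theorem fderiv_fderiv_apply_comm {Q : Type*} [NormedAddCommGroup Q] [NormedSpace ℝ Q]
    {f : Q → E} {q : Q} (hf : ContDiffAt ℝ ∞ f q) (a b : Q) :
    fderiv ℝ (fun z => fderiv ℝ f z a) q b = fderiv ℝ (fun z => fderiv ℝ f z b) q a := by
  have hd : DifferentiableAt ℝ (fderiv ℝ f) q :=
    (hf.fderiv_right (m := ∞) (by simp)).differentiableAt (by simp)
  have h1 : ∀ c, fderiv ℝ (fun z => fderiv ℝ f z c) q = (fderiv ℝ (fderiv ℝ f) q).flip c := by
    intro c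
    rw [fderiv_clm_apply hd (differentiableAt_const c)]
    simp
  rw [h1, h1]
  exact (hf.isSymmSndFDerivAt (by simpa using WithTop.coe_le_coe.2 (le_top : (2 : ℕ∞) ≤ ⊤))).eq b a

theorem contDiffOn_fderiv_apply {Q : Type*} [NormedAddCommGroup Q] [NormedSpace ℝ Q]
    {f : Q → E} {O : Set Q} (hO : IsOpen O) (hf : ContDiffOn ℝ ∞ f O) (a : Q) :
    ContDiffOn ℝ ∞ (fun z => fderiv ℝ f z a) O :=
  (hf.fderiv_of_isOpen hO (by simp)).clm_apply contDiffOn_const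

theorem fderiv_bilinear_symm {B : E → E →L[ℝ] E →L[ℝ] E'} {y : E} (hB : DifferentiableAt ℝ B y)
    (h : ∀ᶠ z in 𝓝 y, ∀ a b, B z a b = B z b a) (c a b : E) :
    fderiv ℝ B y c a b = fderiv ℝ B y c b a := by
  have h1 : ∀ a b, fderiv ℝ (fun z => B z a b) y c = fderiv ℝ B y c a b := by
    intro a b
    rw [fderiv_clm_apply (hB.clm_apply (differentiableAt_const a)) (differentiableAt_const b),
      fderiv_clm_apply hB (differentiableAt_const a)]
    simp
  rw [← h1, ← h1]
  exact DFunLike.congr_fun (Filter.EventuallyEq.fderiv_eq (h.mono fun z hz => hz a b)) c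

/-- The derivative of a family of trajectories with respect to a parameter satisfies the equation of
variations. -/
theorem cov_cov_eq_variationRhs {D : Set E} {G : E → E →L[ℝ] E →L[ℝ] ℝ}
    {Γ : E → E →L[ℝ] E →L[ℝ] E} {Φ : E × E → E} (hS : IsLocalSystem D G Γ Φ)
    {O : Set (P × ℝ)} (hO : IsOpen O) {ψ : P × ℝ → E} (hψ : ContDiffOn ℝ ∞ ψ O)
    (hmaps : MapsTo ψ O D)
    (newton : ∀ q ∈ O, cov Γ (fun s => ψ (q.1, s)) (deriv fun s => ψ (q.1, s)) q.2
      = Φ (ψ q, deriv (fun s => ψ (q.1, s)) q.2))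
    {u : P} {t : ℝ} (hq : (u, t) ∈ O) (α : P) :
    let x : ℝ → E := fun s => ψ (u, s)
    let T : ℝ → E := fun s => fderiv ℝ ψ (u, s) (α, 0)
    cov Γ x (cov Γ x T) t = variationRhs Γ Φ (x t) (deriv x t) (T t) (cov Γ x T t) := by
  intro x T
  set V : P × ℝ → E := fun q => fderiv ℝ ψ q (0, 1) with hVdef
  set A : P × ℝ → E := fun q => fderiv ℝ ψ q (α, 0) with hAdef
  have hV : ContDiffOn ℝ ∞ V O := contDiffOn_fderiv_apply hO hψ _
  have hA : ContDiffOn ℝ ∞ A O := contDiffOn_fderiv_apply hO hψ _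
  have dOn : ∀ {f : P × ℝ → E}, ContDiffOn ℝ ∞ f O → ∀ q ∈ O, DifferentiableAt ℝ f q :=
    fun hf q h => (hf.contDiffAt (hO.mem_nhds h)).differentiableAt (by simp)
  have hΓd : ∀ y ∈ D, DifferentiableAt ℝ Γ y := fun y hy =>
    (hS.smooth_connection.contDiffAt (hS.isOpen.mem_nhds hy)).differentiableAt (by simp)
  have hx : ∀ q ∈ O, HasDerivAt (fun s => ψ (q.1, s)) (V q) q.2 := fun q h =>
    hasDerivAt_slice (dOn hψ q h).hasFDerivAt
  have hx' : ∀ q ∈ O, deriv (fun s => ψ (q.1, s)) =ᶠ[𝓝 q.2] fun s => V (q.1, s) := fun q h => by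
    filter_upwards [eventually_slice hO h] with s hs using (hx (q.1, s) hs).deriv
  -- Newton's law holds on all of `O`, not only on one curve, so it can be differentiated in the
  -- parameter direction `α`.
  have hN : ∀ q ∈ O, fderiv ℝ V q (0, 1) = Φ (ψ q, V q) - Γ (ψ q) (V q) (V q) := by
    intro q h
    have h1 := newton q h
    rw [cov, (hx' q h).deriv_eq, (hx q h).deriv,
      (hasDerivAt_slice (dOn hV q h).hasFDerivAt).deriv] at h1
    exact eq_sub_of_add_eq h1
  have hVA : ∀ q ∈ O, fderiv ℝ V q (α, 0) = fderiv ℝ A q (0, 1) := fun q h =>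
    fderiv_fderiv_apply_comm (hψ.contDiffAt (hO.mem_nhds h)) _ _
  have hZ : ∀ s, (u, s) ∈ O →
      cov Γ x T s = fderiv ℝ V (u, s) (α, 0) + Γ (ψ (u, s)) (V (u, s)) (A (u, s)) := by
    intro s hs
    rw [cov, (hx (u, s) hs).deriv, hVA _ hs,
      (hasDerivAt_slice (dOn hA _ hs).hasFDerivAt : HasDerivAt T _ s).deriv]
  have hyD : ψ (u, t) ∈ D := hmaps hq
  have hVa : ContDiffOn ℝ ∞ (fun q => fderiv ℝ V q (α, 0)) O := contDiffOn_fderiv_apply hO hV _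
  have hVb : ContDiffOn ℝ ∞ (fun q => fderiv ℝ V q (0, 1)) O := contDiffOn_fderiv_apply hO hV _
  have hx0 : HasDerivAt x (V (u, t)) t := hx (u, t) hq
  have hV0 : HasDerivAt (fun s => V (u, s)) (fderiv ℝ V (u, t) (0, 1)) t :=
    hasDerivAt_slice (dOn hV _ hq).hasFDerivAt
  have hA0 : HasDerivAt T (fderiv ℝ A (u, t) (0, 1)) t :=
    hasDerivAt_slice (dOn hA _ hq).hasFDerivAt
  have hZ' : HasDerivAt (cov Γ x T) _ t :=
    ((hasDerivAt_slice (dOn hVa _ hq).hasFDerivAt).add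
      (hasDerivAt_bilinear_along (hΓd _ hyD) hx0 hV0 hA0)).congr_of_eventuallyEq
      ((eventually_slice hO hq).mono fun s hs => hZ s hs)
  -- The only third derivative of `ψ` that occurs: move `∂_t` next to `V`, replace `∂_t V` by
  -- Newton's law, and differentiate the result along `α`.
  have hcross : fderiv ℝ (fun q => fderiv ℝ V q (α, 0)) (u, t) (0, 1)
      = fderiv ℝ Φ (ψ (u, t), V (u, t)) (A (u, t), fderiv ℝ V (u, t) (α, 0))
        - (fderiv ℝ Γ (ψ (u, t)) (A (u, t)) (V (u, t)) (V (u, t))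
          + Γ (ψ (u, t)) (fderiv ℝ V (u, t) (α, 0)) (V (u, t))
          + Γ (ψ (u, t)) (V (u, t)) (fderiv ℝ V (u, t) (α, 0))) := by
    rw [fderiv_fderiv_apply_comm (hV.contDiffAt (hO.mem_nhds hq))]
    have h1 := hasDerivAt_line α (dOn hVb _ hq).hasFDerivAt
    have hψl : HasDerivAt (fun s : ℝ => ψ (u + s • α, t)) (A (u, t)) 0 :=
      hasDerivAt_line α (dOn hψ _ hq).hasFDerivAt
    have hVl := hasDerivAt_line α (dOn hV _ hq).hasFDerivAt
    have hΦd : DifferentiableAt ℝ Φ (ψ (u, t), V (u, t)) :=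
      (hS.smooth_force.contDiffAt ((hS.isOpen.prod isOpen_univ).mem_nhds
        ⟨hyD, mem_univ _⟩)).differentiableAt (by simp)
    have e0 : (u + (0 : ℝ) • α, t) = (u, t) := by simp
    have hΦl : HasDerivAt (fun s : ℝ => Φ (ψ (u + s • α, t), V (u + s • α, t))) _ 0 :=
      HasFDerivAt.comp_hasDerivAt (f := fun s : ℝ => (ψ (u + s • α, t), V (u + s • α, t))) 0
        (by rw [e0]; exact hΦd.hasFDerivAt) (hψl.prodMk hVl)
    have hΓl := hasDerivAt_bilinear_along (B := Γ) (by rw [e0]; exact hΓd _ hyD) hψl hVl hVl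
    have h2 := (hΦl.sub hΓl).congr_of_eventuallyEq (f₁ := fun s : ℝ =>
      fderiv ℝ V (u + s • α, t) (0, 1)) ((eventually_line hO hq α).mono fun s hs => hN _ hs)
    rw [e0] at h2
    exact h1.unique h2
  have hsplit : ∀ a b : E, fderiv ℝ Φ (ψ (u, t), V (u, t)) (a, b)
      = fderiv ℝ Φ (ψ (u, t), V (u, t)) (a, 0) + fderiv ℝ Φ (ψ (u, t), V (u, t)) (0, b) := by
    intro a b
    rw [← map_add]; simp
  -- What remains is algebra. The derivatives of `Γ` and its quadratic terms assemble into `-R(T, v)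
  -- v`, and the velocity derivative of `Φ` is split so that `w = ∂_α V + Γ(V, A)` appears.
  rw [cov, hZ'.deriv, hcross, hx0.deriv, hZ t hq, variationRhs, curv, ← hVA _ hq, hN _ hq]
  have hsym := hS.connection_symm _ hyD
  have hadd : ∀ a b : E, fderiv ℝ Φ (ψ (u, t), V (u, t)) (0, a + b)
      = fderiv ℝ Φ (ψ (u, t), V (u, t)) (0, a) + fderiv ℝ Φ (ψ (u, t), V (u, t)) (0, b) := by
    intro a b
    rw [← map_add]; simp
  have hxt : x t = ψ (u, t) := rfl
  have hTt : T t = A (u, t) := rfl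
  simp only [hxt, hTt]
  rw [hsplit (A (u, t)), hadd]
  rw [hsym (V (u, t)) (A (u, t)), hsym (Φ (ψ (u, t), V (u, t)) - _) (A (u, t)),
    hsym (fderiv ℝ V (u, t) (α, 0)) (V (u, t)),
    fderiv_bilinear_symm (hΓd _ hyD) ((hS.isOpen.mem_nhds hyD |> mem_of_superset) hS.connection_symm)
      (V (u, t)) (V (u, t)) (A (u, t))]
  simp only [map_sub, map_add]
  abel

end LocalTheory

/-! ### Derivatives of the function of deviation and pointwise normality -/

section Deviation

variable {E : Type*} [NormedAddCommGroup E] [NormedSpace ℝ E]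
  {D : Set E} {G : E → E →L[ℝ] E →L[ℝ] ℝ} {Γ : E → E →L[ℝ] E →L[ℝ] E} {Φ : E × E → E}

namespace IsLocalSystem

theorem differentiableAt_metric (hS : IsLocalSystem D G Γ Φ) {y : E} (hy : y ∈ D) :
    DifferentiableAt ℝ G y :=
  (hS.smooth_metric.contDiffAt (hS.isOpen.mem_nhds hy)).differentiableAt (by simp)

theorem contDiffAt_force (hS : IsLocalSystem D G Γ Φ) {y : E} (hy : y ∈ D) (v : E) :
    ContDiffAt ℝ ∞ Φ (y, v) :=
  hS.smooth_force.contDiffAt ((hS.isOpen.prod isOpen_univ).mem_nhds ⟨hy, mem_univ _⟩)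

/-- The connection is compatible with the metric. -/
theorem hasDerivAt_metric (hS : IsLocalSystem D G Γ Φ) {x V W : ℝ → E} {x' V' W' : E} {t : ℝ}
    (hxD : x t ∈ D) (hx : HasDerivAt x x' t) (hV : HasDerivAt V V' t) (hW : HasDerivAt W W' t) :
    HasDerivAt (fun s => G (x s) (V s) (W s))
      (G (x t) (cov Γ x V t) (W t) + G (x t) (V t) (cov Γ x W t)) t := by
  refine (hasDerivAt_bilinear_along (hS.differentiableAt_metric hxD) hx hV hW).congr_deriv ?_
  rw [hS.metric_compat _ hxD, cov, cov, hx.deriv, hV.deriv, hW.deriv]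
  simp only [map_add, add_apply]
  ring

theorem deriv_deviation (hS : IsLocalSystem D G Γ Φ) {I : Set ℝ} (hI : IsOpen I) {x T : ℝ → E}
    (hx : ContDiffOn ℝ ∞ x I) (hT : ContDiffOn ℝ ∞ T I) (hmaps : MapsTo x I D)
    (newton : ∀ s ∈ I, cov Γ x (deriv x) s = Φ (x s, deriv x s)) {t : ℝ} (ht : t ∈ I) :
    HasDerivAt (fun s => G (x s) (deriv x s) (T s))
      (deviationDeriv G Φ (x t) (deriv x t) (T t) (cov Γ x T t)) t := by
  have hx' : ContDiffOn ℝ ∞ (deriv x) I := hx.deriv_of_isOpen hI (by simp)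
  have d : ∀ {f : ℝ → E}, ContDiffOn ℝ ∞ f I → HasDerivAt f (deriv f t) t := fun hf =>
    ((hf.contDiffAt (hI.mem_nhds ht)).differentiableAt (by simp)).hasDerivAt
  have h := hS.hasDerivAt_metric (hmaps ht) (d hx) (d hx') (d hT)
  rwa [newton t ht] at h

/-- Apply metric compatibility to both terms of `φ' = G(Φ, T) + G(v, ∇_t T)`. Newton's law turns
`∇_t v` into `Φ` and produces the cross term twice. The equation of variations enters only at the
instant `t` itself. -/
theorem deriv2_deviation (hS : IsLocalSystem D G Γ Φ) {I : Set ℝ} (hI : IsOpen I) {x T : ℝ → E}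
    (hx : ContDiffOn ℝ ∞ x I) (hT : ContDiffOn ℝ ∞ T I) (hmaps : MapsTo x I D)
    (newton : ∀ s ∈ I, cov Γ x (deriv x) s = Φ (x s, deriv x s)) {t : ℝ} (ht : t ∈ I)
    (hvar : cov Γ x (cov Γ x T) t
      = variationRhs Γ Φ (x t) (deriv x t) (T t) (cov Γ x T t)) :
    HasDerivAt (deriv fun s => G (x s) (deriv x s) (T s))
      (deviationDeriv2 G Γ Φ (x t) (deriv x t) (T t) (cov Γ x T t)) t := by
  have hx' : ContDiffOn ℝ ∞ (deriv x) I := hx.deriv_of_isOpen hI (by simp)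
  have hT' : ContDiffOn ℝ ∞ (deriv T) I := hT.deriv_of_isOpen hI (by simp)
  have d : ∀ {f : ℝ → E}, ContDiffOn ℝ ∞ f I → HasDerivAt f (deriv f t) t := fun hf =>
    ((hf.contDiffAt (hI.mem_nhds ht)).differentiableAt (by simp)).hasDerivAt
  have hcov : ContDiffOn ℝ ∞ (cov Γ x T) I :=
    hT'.add (((hS.smooth_connection.comp hx hmaps).clm_apply hx').clm_apply hT)
  have hF : HasDerivAt (fun s => Φ (x s, deriv x s)) _ t :=
    HasFDerivAt.comp_hasDerivAt (f := fun s => (x s, deriv x s)) t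
      ((hS.contDiffAt_force (hmaps ht) (deriv x t)).differentiableAt (by simp)).hasFDerivAt
      ((d hx).prodMk (d hx'))
  have hcovF : cov Γ x (fun s => Φ (x s, deriv x s)) t = forceDeriv Γ Φ (x t) (deriv x t) := by
    rw [cov, hF.deriv, forceDeriv, ← newton t ht, cov]
    simp
  have h1 := hS.hasDerivAt_metric (hmaps ht) (d hx) hF (d hT)
  have h2 := hS.hasDerivAt_metric (hmaps ht) (d hx) (d hx') (d hcov)
  refine ((h1.add h2).congr_of_eventuallyEq ?_).congr_deriv ?_
  · filter_upwards [hI.mem_nhds ht] with s hs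
    exact (hS.deriv_deviation hI hx hT hmaps newton hs).deriv
  · rw [hcovF, newton t ht, hvar, deviationDeriv2]
    ring

end IsLocalSystem

/-- Joint linearity in the Cauchy data `(T, w)`. The form with one scalar suffices for subtracting
multiples of test data. -/
theorem variationRhs_add_smul (y v T₁ T₂ w₁ w₂ : E) (c : ℝ) :
    variationRhs Γ Φ y v (T₁ + c • T₂) (w₁ + c • w₂)
      = variationRhs Γ Φ y v T₁ w₁ + c • variationRhs Γ Φ y v T₂ w₂ := by
  have h1 : ∀ a b : E, ((a + c • b, 0) : E × E) = (a, 0) + c • (b, 0) := by intros; simp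
  have h2 : ∀ a b : E, ((0, a + c • b) : E × E) = (0, a) + c • (0, b) := by intros; simp
  simp only [variationRhs, curv, map_add, map_smul, h1, h2, add_apply, smul_apply, smul_add, smul_sub, smul_neg]
  abel

theorem deviationDeriv_add_smul (y v T₁ T₂ w₁ w₂ : E) (c : ℝ) :
    deviationDeriv G Φ y v (T₁ + c • T₂) (w₁ + c • w₂)
      = deviationDeriv G Φ y v T₁ w₁ + c * deviationDeriv G Φ y v T₂ w₂ := by
  simp only [deviationDeriv, map_add, map_smul, smul_eq_mul]
  ring

theorem deviationDeriv2_add_smul (y v T₁ T₂ w₁ w₂ : E) (c : ℝ) :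
    deviationDeriv2 G Γ Φ y v (T₁ + c • T₂) (w₁ + c • w₂)
      = deviationDeriv2 G Γ Φ y v T₁ w₁ + c * deviationDeriv2 G Γ Φ y v T₂ w₂ := by
  simp only [deviationDeriv2, variationRhs_add_smul, map_add, map_smul, smul_eq_mul]
  ring

/-- Pointwise weak normality: `φ'' = 0` whenever `φ = 0` and `φ' = 0` (off the zero section). -/
def IsPointwiseNormal (D : Set E) (G : E → E →L[ℝ] E →L[ℝ] ℝ) (Γ : E → E →L[ℝ] E →L[ℝ] E)
    (Φ : E × E → E) : Prop :=
  ∀ y ∈ D, ∀ v, v ≠ 0 → ∀ T w, G y v T = 0 → deviationDeriv G Φ y v T w = 0 →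
    deviationDeriv2 G Γ Φ y v T w = 0

/-- The coefficient of `φ'` in the equation of weak normality. -/
def normalCoeffA (G : E → E →L[ℝ] E →L[ℝ] ℝ) (Γ : E → E →L[ℝ] E →L[ℝ] E) (Φ : E × E → E)
    (y v : E) : ℝ :=
  deviationDeriv2 G Γ Φ y v 0 v / G y v v

/-- The coefficient of `φ` in the equation of weak normality. -/
def normalCoeffB (G : E → E →L[ℝ] E →L[ℝ] ℝ) (Γ : E → E →L[ℝ] E →L[ℝ] E) (Φ : E × E → E)
    (y v : E) : ℝ :=
  (deviationDeriv2 G Γ Φ y v v 0 - normalCoeffA G Γ Φ y v * deviationDeriv G Φ y v v 0) / G y v v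

/-- A functional vanishing on the common kernel of two others is a combination of them. The test
data `(v, 0)` and `(0, v)` give `(φ, φ')` the values `(G(v,v), G(Φ,v))` and `(0, G(v,v))`. This
system is triangular with nonzero diagonal, so suitable multiples `α` and `β` bring any `(T, w)`
into the kernel. -/
theorem IsPointwiseNormal.deviationDeriv2_eq (hN : IsPointwiseNormal D G Γ Φ)
    (hS : IsLocalSystem D G Γ Φ) {y : E} (hy : y ∈ D) {v : E} (hv : v ≠ 0) (T w : E) :
    deviationDeriv2 G Γ Φ y v T w = normalCoeffA G Γ Φ y v * deviationDeriv G Φ y v T w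
      + normalCoeffB G Γ Φ y v * G y v T := by
  have hpos : G y v v ≠ 0 := (hS.metric_pos y hy v hv).ne'
  set α := G y v T / G y v v with hα
  set β := (deviationDeriv G Φ y v T w - α * deviationDeriv G Φ y v v 0) / G y v v with hβ
  have h0 : deviationDeriv G Φ y v 0 v = G y v v := by simp [deviationDeriv]
  -- The zero summands put both components into the shape in which linearity applies twice.
  have e1 : T + (-α) • v + (-β) • 0 = T + (-α) • v := by simp
  have e2 : w + (-α) • 0 + (-β) • v = w + (-β) • v := by simp
  have hmain := hN y hy v hv (T + (-α) • v) (w + (-β) • v)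
    (by simp [hα, hpos])
    (by
      rw [← e1, ← e2, deviationDeriv_add_smul, deviationDeriv_add_smul, h0, hβ]
      field_simp
      ring)
  rw [← e1, ← e2, deviationDeriv2_add_smul, deviationDeriv2_add_smul] at hmain
  have h3 : deviationDeriv2 G Γ Φ y v T w
      = α * deviationDeriv2 G Γ Φ y v v 0 + β * deviationDeriv2 G Γ Φ y v 0 v := by linarith
  rw [h3, normalCoeffB, normalCoeffA, hβ, hα]
  field_simp
  ring

theorem continuousAt_trilinear_apply {f : ℝ → E →L[ℝ] E →L[ℝ] E →L[ℝ] E} {a b c : ℝ → E} {t : ℝ}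
    (hf : ContinuousAt f t) (ha : ContinuousAt a t) (hb : ContinuousAt b t)
    (hc : ContinuousAt c t) : ContinuousAt (fun s => f s (a s) (b s) (c s)) t := by
  have h1 : ContinuousAt (fun s => f s (a s)) t := by
    have h := fun h => ContinuousAt.clm_apply (𝕜 := ℝ) (E := E) (F := E →L[ℝ] E →L[ℝ] E) (f := f)
      (g := a) (x := t) h
    have h' := h ?_ ha
    · exact h'
    · exact hf
  exact (h1.clm_apply hb).clm_apply hc

theorem IsLocalSystem.continuousAt_deviationDeriv2 (hS : IsLocalSystem D G Γ Φ)
    {y v T w : ℝ → E} {t : ℝ} (hyt : y t ∈ D) (hy : ContinuousAt y t) (hv : ContinuousAt v t)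
    (hT : ContinuousAt T t) (hw : ContinuousAt w t) :
    ContinuousAt (fun s => deviationDeriv2 G Γ Φ (y s) (v s) (T s) (w s)) t := by
  have hG : ContinuousAt (fun s => G (y s)) t :=
    ContinuousAt.comp (g := G) (hS.differentiableAt_metric hyt).continuousAt hy
  have hΓt := hS.smooth_connection.contDiffAt (hS.isOpen.mem_nhds hyt)
  have hΓ : ContinuousAt (fun s => Γ (y s)) t := ContinuousAt.comp (g := Γ) hΓt.continuousAt hy
  have hΓ' : ContinuousAt (fun s => fderiv ℝ Γ (y s)) t :=
    ContinuousAt.comp (g := fderiv ℝ Γ)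
      (hΓt.fderiv_right (m := ∞) (by simp)).continuousAt hy
  have hyv : ContinuousAt (fun s => (y s, v s)) t := hy.prodMk hv
  have hΦt := hS.contDiffAt_force hyt (v t)
  have hΦ : ContinuousAt (fun s => Φ (y s, v s)) t :=
    ContinuousAt.comp (g := Φ) (f := fun s => (y s, v s)) hΦt.continuousAt hyv
  have hΦ' : ContinuousAt (fun s => fderiv ℝ Φ (y s, v s)) t :=
    ContinuousAt.comp (g := fderiv ℝ Φ) (f := fun s => (y s, v s))
      (hΦt.fderiv_right (m := ∞) (by simp)).continuousAt hyv
  unfold deviationDeriv2 variationRhs forceDeriv curv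
  -- Each factor is named as a function of `s` alone; the goal becomes a combination of sums,
  -- products and evaluations of continuous functions.
  obtain ⟨G', hG'⟩ : ∃ f : ℝ → _, ∀ s, G (y s) = f s := ⟨_, fun _ => rfl⟩
  obtain ⟨Γ₀, hΓ₀⟩ : ∃ f : ℝ → _, ∀ s, Γ (y s) = f s := ⟨_, fun _ => rfl⟩
  have h₁ := continuousAt_trilinear_apply hΓ' hT hv hv
  have h₂ := continuousAt_trilinear_apply hΓ' hv hT hv
  obtain ⟨k₁, hk₁⟩ : ∃ f : ℝ → E, ∀ s, fderiv ℝ Γ (y s) (T s) (v s) (v s) = f s :=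
    ⟨_, fun _ => rfl⟩
  obtain ⟨k₂, hk₂⟩ : ∃ f : ℝ → E, ∀ s, fderiv ℝ Γ (y s) (v s) (T s) (v s) = f s :=
    ⟨_, fun _ => rfl⟩
  obtain ⟨Φ₀, hΦ₀⟩ : ∃ f : ℝ → _, ∀ s, Φ (y s, v s) = f s := ⟨_, fun _ => rfl⟩
  obtain ⟨Φ₁, hΦ₁⟩ : ∃ f : ℝ → _, ∀ s, fderiv ℝ Φ (y s, v s) = f s := ⟨_, fun _ => rfl⟩
  simp only [hG', hΓ₀, hk₁, hk₂, hΦ₀, hΦ₁] at hG hΓ h₁ h₂ hΦ hΦ' ⊢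
  fun_prop

theorem IsLocalSystem.continuousAt_normalCoeff (hS : IsLocalSystem D G Γ Φ) {y v : ℝ → E} {t : ℝ}
    (hyt : y t ∈ D) (hvt : v t ≠ 0) (hy : ContinuousAt y t) (hv : ContinuousAt v t) :
    ContinuousAt (fun s => normalCoeffA G Γ Φ (y s) (v s)) t ∧
      ContinuousAt (fun s => normalCoeffB G Γ Φ (y s) (v s)) t := by
  have hG : ContinuousAt (fun s => G (y s)) t :=
    ContinuousAt.comp (g := G) (hS.differentiableAt_metric hyt).continuousAt hy
  have hΦ : ContinuousAt (fun s => Φ (y s, v s)) t :=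
    ContinuousAt.comp (g := Φ) (f := fun s => (y s, v s))
      (hS.contDiffAt_force hyt (v t)).continuousAt (hy.prodMk hv)
  have hpos : G (y t) (v t) (v t) ≠ 0 := (hS.metric_pos _ hyt _ hvt).ne'
  have hA : ContinuousAt (fun s => normalCoeffA G Γ Φ (y s) (v s)) t :=
    (hS.continuousAt_deviationDeriv2 hyt hy hv continuousAt_const hv).div
      ((hG.clm_apply hv).clm_apply hv) hpos
  refine ⟨hA, ContinuousAt.div ?_ ((hG.clm_apply hv).clm_apply hv) hpos⟩
  refine (hS.continuousAt_deviationDeriv2 hyt hy hv hv continuousAt_const).sub (hA.mul ?_)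
  exact ((hG.clm_apply hΦ).clm_apply hv).add ((hG.clm_apply hv).clm_apply continuousAt_const)

/-- Pointwise normality forces a force field smooth at `v = 0` to vanish there. -/
theorem IsPointwiseNormal.force_zero (hN : IsPointwiseNormal D G Γ Φ)
    (hS : IsLocalSystem D G Γ Φ) [FiniteDimensional ℝ E] (hdim : 2 ≤ Module.finrank ℝ E)
    {y : E} (hy : y ∈ D) : Φ (y, 0) = 0 := by
  have key : ∀ w, G y (Φ (y, 0)) w = 0 := by
    intro w
    -- In dimension at least two there is a direction `N ≠ 0` orthogonal to `w`. With `v = s N` and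
    -- `T = 0` both `φ` and `φ'` vanish, so the pointwise condition applies for each `s ≠ 0`.
    have hker : LinearMap.ker (G y w).toLinearMap ≠ ⊥ :=
      LinearMap.ker_ne_bot_of_finrank_lt (by rw [Module.finrank_self]; omega)
    obtain ⟨N, hNw, hN0⟩ := (Submodule.ne_bot_iff _).1 hker
    have hwN : G y w N = 0 := hNw
    have h1 : ∀ s : ℝ, s ≠ 0 →
        2 * G y (Φ (y, s • N)) w + G y (s • N) (fderiv ℝ Φ (y, s • N) (0, w)) = 0 := by
      intro s hs
      have h := hN y hy (s • N) (smul_ne_zero hs hN0) 0 w (by simp)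
        (by simp [deviationDeriv, hS.metric_symm y hy N w, hwN])
      have e : variationRhs Γ Φ y (s • N) 0 w = fderiv ℝ Φ (y, s • N) (0, w) := by
        have e0 : ((0, 0) : E × E) = 0 := rfl
        simp [variationRhs, curv, e0]
      rwa [deviationDeriv2, e, map_zero, zero_add] at h
    -- As `s → 0` the second term of `h1` disappears, because it carries the factor `s N` and the
    -- derivative of `Φ` stays bounded.
    have hc : ContinuousAt (fun s : ℝ => (y, s • N)) 0 := by fun_prop
    have hΦ0 : ContDiffAt ℝ ∞ Φ (y, (0 : ℝ) • N) := hS.contDiffAt_force hy _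
    have hΦ : ContinuousAt (fun s : ℝ => Φ (y, s • N)) 0 :=
      ContinuousAt.comp (g := Φ) (f := fun s : ℝ => (y, s • N)) hΦ0.continuousAt hc
    have hΦ' : ContinuousAt (fun s : ℝ => fderiv ℝ Φ (y, s • N)) 0 :=
      ContinuousAt.comp (g := fderiv ℝ Φ) (f := fun s : ℝ => (y, s • N))
        (hΦ0.fderiv_right (m := ∞) (by simp)).continuousAt hc
    have hcont : ContinuousAt (fun s : ℝ =>
        2 * G y (Φ (y, s • N)) w + G y (s • N) (fderiv ℝ Φ (y, s • N) (0, w))) 0 := by fun_prop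
    have hlim := hcont.tendsto.mono_left (nhdsWithin_le_nhds (s := {0}ᶜ))
    have hlim0 := tendsto_nhds_unique hlim
      ((tendsto_const_nhds (x := (0 : ℝ))).congr' (by
        filter_upwards [self_mem_nhdsWithin] with s hs using (h1 s hs).symm))
    simpa using hlim0
  by_contra h
  exact (hS.metric_pos y hy _ h).ne' (key _)

/-- If the force vanishes on the zero section, a trajectory with zero velocity at some moment of time
is constant near it. -/
theorem IsLocalSystem.eventually_velocity_eq_zero (hS : IsLocalSystem D G Γ Φ)
    (hΦ0 : ∀ y ∈ D, Φ (y, 0) = 0) {I : Set ℝ} (hI : IsOpen I) {x : ℝ → E}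
    (hx : ContDiffOn ℝ ∞ x I) (hmaps : MapsTo x I D)
    (newton : ∀ s ∈ I, cov Γ x (deriv x) s = Φ (x s, deriv x s)) {t : ℝ} (ht : t ∈ I)
    (h0 : deriv x t = 0) : ∀ᶠ s in 𝓝 t, deriv x s = 0 := by
  -- With the position `x(s)` regarded as known, the velocity solves the first-order equation `w' =
  -- f(x(s), w)`. The zero function is another solution, because `f(x, 0) = Φ(x, 0) = 0`.
  set f : E × E → E := fun z => Φ z - Γ z.1 z.2 z.2 with hf
  have hx' : ContDiffOn ℝ ∞ (deriv x) I := hx.deriv_of_isOpen hI (by simp)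
  have hfc : ContDiffAt ℝ ∞ f (x t, 0) := by
    have hΓ : ContDiffAt ℝ ∞ (fun z : E × E => Γ z.1) (x t, 0) :=
      ContDiffAt.comp (x t, 0) (hS.smooth_connection.contDiffAt (hS.isOpen.mem_nhds (hmaps ht)))
        contDiffAt_fst
    exact (hS.contDiffAt_force (hmaps ht) 0).sub
      ((hΓ.clm_apply contDiffAt_snd).clm_apply contDiffAt_snd)
  obtain ⟨K, U, hU, hK⟩ := (hfc.of_le (by simp : (1 : WithTop ℕ∞) ≤ ∞)).exists_lipschitzOnWith
  have hxt : ContinuousAt x t := hx.continuousOn.continuousAt (hI.mem_nhds ht)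
  have hvt : ContinuousAt (deriv x) t := hx'.continuousOn.continuousAt (hI.mem_nhds ht)
  have hU1 : ∀ᶠ s in 𝓝 t, (x s, deriv x s) ∈ U :=
    (hxt.prodMk hvt).eventually (by rw [h0]; exact hU : ∀ᶠ z in 𝓝 (x t, deriv x t), z ∈ U)
  have hU0 : ∀ᶠ s in 𝓝 t, (x s, (0 : E)) ∈ U :=
    (hxt.prodMk continuousAt_const).eventually hU
  refine ODE_solution_unique_of_eventually (v := fun s w => f (x s, w)) (K := K)
    (s := fun s => {w | (x s, w) ∈ U}) (g := fun _ => 0) (.of_forall fun s => ?_) ?_ ?_ h0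
  · intro a ha b hb
    simpa [Prod.edist_eq] using hK ha hb
  · filter_upwards [hU1, hI.mem_nhds ht] with s hs hsI
    refine ⟨?_, hs⟩
    have := newton s hsI
    rw [cov] at this
    rw [hf]
    change HasDerivAt _ (Φ (x s, deriv x s) - Γ (x s) (deriv x s) (deriv x s)) s
    rw [← eq_sub_of_add_eq this]
    exact ((hx'.contDiffAt (hI.mem_nhds hsI)).differentiableAt (by simp)).hasDerivAt
  · filter_upwards [hU0, hI.mem_nhds ht] with s hs hsI
    refine ⟨?_, hs⟩
    have : f (x s, 0) = 0 := by simp [hf, hΦ0 _ (hmaps hsI)]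
    rw [this]
    exact hasDerivAt_const _ _

end Deviation

/-- A solution of a linear homogeneous ODE of the second order with zero Cauchy data is zero. -/
theorem eq_zero_of_linear_ode2 {ε : ℝ} {A B φ φ' : ℝ → ℝ} (hA : ContinuousOn A (Ioo (-ε) ε))
    (hB : ContinuousOn B (Ioo (-ε) ε)) (h1 : ∀ t ∈ Ioo (-ε) ε, HasDerivAt φ (φ' t) t)
    (h2 : ∀ t ∈ Ioo (-ε) ε, HasDerivAt φ' (A t * φ' t + B t * φ t) t) (h0 : φ 0 = 0)
    (h0' : φ' 0 = 0) {t : ℝ} (ht : t ∈ Ioo (-ε) ε) : φ t = 0 := by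
  -- The coefficients may be unbounded near the ends of the interval; they are bounded on a compact
  -- interval `[-r, r]` whose interior contains `t`.
  obtain ⟨r, hr1, hr2⟩ := exists_between (abs_lt.2 ht)
  have hsub : Icc (-r) r ⊆ Ioo (-ε) ε := fun s hs => ⟨by linarith [hs.1], by linarith [hs.2]⟩
  obtain ⟨a, ha⟩ := isCompact_Icc.exists_bound_of_continuousOn (hA.mono hsub)
  obtain ⟨b, hb⟩ := isCompact_Icc.exists_bound_of_continuousOn (hB.mono hsub)
  have hr0 : 0 < r := (abs_nonneg t).trans_lt hr1
  have ha0 : 0 ≤ a := (norm_nonneg _).trans (ha 0 ⟨by linarith, hr0.le⟩)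
  have hb0 : 0 ≤ b := (norm_nonneg _).trans (hb 0 ⟨by linarith, hr0.le⟩)
  -- Uniqueness for the first-order system satisfied by `(φ, φ')`. In the sup norm, `1` bounds the
  -- first row, `a + b` bounds the second, and their sum serves as a Lipschitz constant.
  have h := ODE_solution_unique_of_mem_Ioo (f := fun s => (φ s, φ' s)) (g := fun _ => (0, 0))
    (v := fun s z => (z.2, A s * z.2 + B s * z.1)) (s := fun _ => univ)
    (K := (1 + a + b).toNNReal) (a := -r) (b := r) (t₀ := 0) ?_ ⟨by linarith, hr0⟩ ?_ ?_ ?_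
    (abs_lt.1 hr1)
  · exact congrArg Prod.fst h
  · intro s hs
    refine (LipschitzWith.of_dist_le_mul fun z w => ?_).lipschitzOnWith
    have hs' := Ioo_subset_Icc_self hs
    have hA' := ha s hs'
    have hB' := hb s hs'
    rw [Real.coe_toNNReal _ (by linarith), dist_eq_norm, dist_eq_norm]
    have hz1 : ‖(z - w).1‖ ≤ ‖z - w‖ := norm_fst_le _
    have hz2 : ‖(z - w).2‖ ≤ ‖z - w‖ := norm_snd_le _
    have hn := norm_nonneg (z - w)
    refine max_le ?_ ?_
    · change ‖z.2 - w.2‖ ≤ _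
      refine hz2.trans ?_
      nlinarith
    · change ‖(A s * z.2 + B s * z.1) - (A s * w.2 + B s * w.1)‖ ≤ _
      have e : (A s * z.2 + B s * z.1) - (A s * w.2 + B s * w.1)
          = A s * (z - w).2 + B s * (z - w).1 := by simp; ring
      rw [e]
      calc _ ≤ ‖A s‖ * ‖(z - w).2‖ + ‖B s‖ * ‖(z - w).1‖ := by
            rw [← norm_mul, ← norm_mul]; exact norm_add_le _ _
        _ ≤ a * ‖z - w‖ + b * ‖z - w‖ := by gcongr
        _ ≤ _ := by nlinarith
  · intro s hs
    have hs' := hsub (Ioo_subset_Icc_self hs)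
    exact ⟨(h1 s hs').prodMk (h2 s hs'), mem_univ _⟩
  · intro s hs
    refine ⟨?_, mem_univ _⟩
    simpa [Prod.mk_zero_zero] using hasDerivAt_const s (0 : ℝ × ℝ)
  · simp [h0, h0']

/-! ### Geometry in a chart -/

section Chart

variable {n : ℕ} {M : Type*} [TopologicalSpace M] [ChartedSpace (EuclideanSpace ℝ (Fin n)) M]
  [IsManifold (𝓡 n) ∞ M] {e : OpenPartialHomeomorph M (EuclideanSpace ℝ (Fin n))}

theorem mdifferentiable_of_mem_maximalAtlas (he : e ∈ IsManifold.maximalAtlas (𝓡 n) ∞ M) :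
    e.MDifferentiable (𝓡 n) (𝓡 n) :=
  ⟨(contMDiffOn_of_mem_maximalAtlas he).mdifferentiableOn (by simp),
    (contMDiffOn_symm_of_mem_maximalAtlas he).mdifferentiableOn (by simp)⟩

theorem coordOfVec_vecOfCoord (he : e ∈ IsManifold.maximalAtlas (𝓡 n) ∞ M)
    {y : EuclideanSpace ℝ (Fin n)} (hy : y ∈ e.target) (w : EuclideanSpace ℝ (Fin n)) :
    coordOfVec e (e.symm y) (vecOfCoord e y w) = w :=
  DFunLike.congr_fun ((mdifferentiable_of_mem_maximalAtlas he).comp_symm_deriv hy) w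

theorem coordOfVec_injective (he : e ∈ IsManifold.maximalAtlas (𝓡 n) ∞ M) {p : M}
    (hp : p ∈ e.source) : Function.Injective (coordOfVec e p) :=
  (mdifferentiable_of_mem_maximalAtlas he).mfderiv_injective hp

theorem vecOfCoord_coordOfVec (he : e ∈ IsManifold.maximalAtlas (𝓡 n) ∞ M)
    {y : EuclideanSpace ℝ (Fin n)} (hy : y ∈ e.target) (w : TangentSpace (𝓡 n) (e.symm y)) :
    vecOfCoord e y (coordOfVec e (e.symm y) w) = w :=
  coordOfVec_injective he (e.map_target hy) (coordOfVec_vecOfCoord he hy _)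

variable {EQ : Type*} [NormedAddCommGroup EQ] [NormedSpace ℝ EQ] {HQ : Type*} [TopologicalSpace HQ]
  {J : ModelWithCorners ℝ EQ HQ} {Q : Type*} [TopologicalSpace Q] [ChartedSpace HQ Q]

theorem contMDiffOn_tangentBundle_mk {V : Type*} [NormedAddCommGroup V] [NormedSpace ℝ V]
    {f w : Q → V} {s : Set Q} (hf : ContMDiffOn J 𝓘(ℝ, V) ∞ f s)
    (hw : ContMDiffOn J 𝓘(ℝ, V) ∞ w s) :
    ContMDiffOn J 𝓘(ℝ, V).tangent ∞ (fun q => (⟨f q, w q⟩ : TangentBundle 𝓘(ℝ, V) V)) s := by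
  intro q hq
  apply Bundle.contMDiffWithinAt_totalSpace.2
  refine ⟨hf q hq, ?_⟩
  convert! hw q hq with y
  simp

theorem contMDiffOn_vecOfCoord (he : e ∈ IsManifold.maximalAtlas (𝓡 n) ∞ M)
    {f w : Q → EuclideanSpace ℝ (Fin n)} {s : Set Q} (hf : ContMDiffOn J (𝓡 n) ∞ f s)
    (hw : ContMDiffOn J (𝓡 n) ∞ w s) (hmaps : MapsTo f s e.target) :
    ContMDiffOn J (𝓡 n).tangent ∞
      (fun q => (⟨e.symm (f q), vecOfCoord e (f q) (w q)⟩ : TangentBundle (𝓡 n) M)) s := by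
  have h1 := (contMDiffOn_symm_of_mem_maximalAtlas he).contMDiffOn_tangentMapWithin (m := ∞)
    (by simp) e.open_target.uniqueMDiffOn
  refine (h1.comp (contMDiffOn_tangentBundle_mk hf hw) hmaps).congr fun q hq => ?_
  simp [tangentMapWithin, vecOfCoord, mfderivWithin_of_isOpen e.open_target (hmaps hq)]

theorem contMDiffOn_coordOfVec (he : e ∈ IsManifold.maximalAtlas (𝓡 n) ∞ M)
    {h : Q → TangentBundle (𝓡 n) M} {s : Set Q} (hh : ContMDiffOn J (𝓡 n).tangent ∞ h s)
    (hmaps : MapsTo (fun q => (h q).1) s e.source) :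
    ContMDiffOn J (𝓡 n) ∞ (fun q => coordOfVec e (h q).1 (h q).2) s := by
  have h1 := (contMDiffOn_of_mem_maximalAtlas he).contMDiffOn_tangentMapWithin (m := ∞)
    (by simp) e.open_source.uniqueMDiffOn
  have h2 := (contMDiff_snd_tangentBundle_modelSpace (EuclideanSpace ℝ (Fin n)) (𝓡 n)
    (n := ∞)).comp_contMDiffOn (h1.comp hh hmaps)
  refine h2.congr fun q hq => ?_
  change _ = mfderivWithin (𝓡 n) (𝓡 n) e e.source (h q).1 (h q).2
  rw [mfderivWithin_of_isOpen e.open_source (hmaps hq), coordOfVec]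

variable (g : Bundle.ContMDiffRiemannianMetric (𝓡 n) ∞ (EuclideanSpace ℝ (Fin n))
    (fun p : M => TangentSpace (𝓡 n) p))

theorem contDiffOn_metricMatrix (he : e ∈ IsManifold.maximalAtlas (𝓡 n) ∞ M) (i j : Fin n) :
    ContDiffOn ℝ ∞ (fun y => metricMatrix g e y i j) e.target := by
  rw [← contMDiffOn_iff_contDiffOn]
  intro y hy
  have hv : ∀ w, ContMDiffOn (𝓡 n) (𝓡 n).tangent ∞ (fun y =>
      (⟨e.symm y, vecOfCoord e y w⟩ : TangentBundle (𝓡 n) M)) e.target := fun w =>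
    contMDiffOn_vecOfCoord he contMDiffOn_id contMDiffOn_const (mapsTo_id _)
  have hb := contMDiffOn_symm_of_mem_maximalAtlas he y hy
  have : ContMDiffWithinAt (𝓡 n) ((𝓡 n).prod 𝓘(ℝ)) ∞
      (fun y => Bundle.TotalSpace.mk' ℝ (E := Bundle.Trivial M ℝ) (e.symm y)
        (g.inner (e.symm y) (vecOfCoord e y (stdVec i)) (vecOfCoord e y (stdVec j)))) e.target y := by
    apply ContMDiffWithinAt.clm_bundle_apply₂ (F₁ := EuclideanSpace ℝ (Fin n))
      (F₂ := EuclideanSpace ℝ (Fin n))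
    · exact ContMDiffAt.comp_contMDiffWithinAt y g.contMDiff.contMDiffAt hb
    · exact hv _ y hy
    · exact hv _ y hy
  simp only [Bundle.contMDiffWithinAt_totalSpace] at this
  exact this.2

theorem metricMatrix_symm (y : EuclideanSpace ℝ (Fin n)) (i j : Fin n) :
    metricMatrix g e y i j = metricMatrix g e y j i :=
  g.symm _ _ _

/-- The metric in the chart `e`. -/
def chartMetric (e : OpenPartialHomeomorph M (EuclideanSpace ℝ (Fin n)))
    (y : EuclideanSpace ℝ (Fin n)) :
    EuclideanSpace ℝ (Fin n) →L[ℝ] EuclideanSpace ℝ (Fin n) →L[ℝ] ℝ :=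
  ∑ i, ∑ j, metricMatrix g e y i j •
    (EuclideanSpace.proj (𝕜 := ℝ) i).smulRight (EuclideanSpace.proj (𝕜 := ℝ) j)

/-- The Levi-Civita connection in the chart `e`. -/
def chartConnection (e : OpenPartialHomeomorph M (EuclideanSpace ℝ (Fin n)))
    (y : EuclideanSpace ℝ (Fin n)) :
    EuclideanSpace ℝ (Fin n) →L[ℝ] EuclideanSpace ℝ (Fin n) →L[ℝ] EuclideanSpace ℝ (Fin n) :=
  ∑ k, ∑ i, ∑ j, christoffel g e k i j y •
    (EuclideanSpace.proj (𝕜 := ℝ) i).smulRight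
      ((EuclideanSpace.proj (𝕜 := ℝ) j).smulRight (stdVec k))

theorem chartMetric_apply (y a b : EuclideanSpace ℝ (Fin n)) :
    chartMetric g e y a b = ∑ i, ∑ j, metricMatrix g e y i j * (a i * b j) := by
  simp [chartMetric]

theorem stdVec_apply (i j : Fin n) : stdVec i j = if j = i then (1 : ℝ) else 0 := by
  simp [stdVec]

theorem sum_smul_stdVec (w : EuclideanSpace ℝ (Fin n)) : ∑ i, w i • stdVec i = w := by
  ext j
  simp [stdVec_apply]

theorem chartConnection_apply (y a b : EuclideanSpace ℝ (Fin n)) (k : Fin n) :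
    chartConnection g e y a b k = ∑ i, ∑ j, christoffel g e k i j y * (a i * b j) := by
  have h : ∀ l, stdVec l k = if k = l then (1 : ℝ) else 0 := fun l => stdVec_apply l k
  simp only [chartConnection, sum_apply, ContinuousLinearMap.smulRight_apply, smul_apply,
    PiLp.proj_apply, WithLp.ofLp_sum, Finset.sum_apply, WithLp.ofLp_smul, Pi.smul_apply, h,
    smul_eq_mul]
  rw [Finset.sum_eq_single k]
  · simp
  · intro l _ hl
    simp [Ne.symm hl]
  · simp

theorem chartMetric_eq_inner (y a b : EuclideanSpace ℝ (Fin n)) :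
    chartMetric g e y a b = g.inner (e.symm y) (vecOfCoord e y a) (vecOfCoord e y b) := by
  have h : ∀ w, vecOfCoord e y w = ∑ i, w i • vecOfCoord e y (stdVec i) := by
    intro w
    let L : EuclideanSpace ℝ (Fin n) →L[ℝ] TangentSpace (𝓡 n) (e.symm y) :=
      mfderiv (𝓡 n) (𝓡 n) e.symm y
    have hL : L (∑ i, w i • stdVec i) = ∑ i, w i • L (stdVec i) := by simp [map_sum]
    rwa [sum_smul_stdVec] at hL
  rw [chartMetric_apply, h a, h b]
  simp only [map_sum, map_smul, sum_apply, smul_apply, smul_eq_mul,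
    Finset.mul_sum, metricMatrix, Matrix.of_apply]
  rw [Finset.sum_comm]
  refine Finset.sum_congr rfl fun i _ => Finset.sum_congr rfl fun j _ => ?_
  ring

theorem inner_eq_chartMetric (he : e ∈ IsManifold.maximalAtlas (𝓡 n) ∞ M) {p : M}
    (hp : p ∈ e.source) (a b : TangentSpace (𝓡 n) p) :
    g.inner p a b = chartMetric g e (e p) (coordOfVec e p a) (coordOfVec e p b) := by
  obtain ⟨y, hy, rfl⟩ : ∃ y ∈ e.target, e.symm y = p := ⟨e p, e.map_source hp, e.left_inv hp⟩
  rw [e.right_inv hy, chartMetric_eq_inner, vecOfCoord_coordOfVec he hy,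
    vecOfCoord_coordOfVec he hy]

theorem chartMetric_symm (y a b : EuclideanSpace ℝ (Fin n)) :
    chartMetric g e y a b = chartMetric g e y b a := by
  rw [chartMetric_eq_inner, chartMetric_eq_inner, g.symm]

theorem chartMetric_pos (he : e ∈ IsManifold.maximalAtlas (𝓡 n) ∞ M)
    {y : EuclideanSpace ℝ (Fin n)} (hy : y ∈ e.target) {a : EuclideanSpace ℝ (Fin n)}
    (ha : a ≠ 0) : 0 < chartMetric g e y a a := by
  rw [chartMetric_eq_inner]
  refine g.pos _ _ fun h => ha ?_
  rw [← coordOfVec_vecOfCoord he hy a, h]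
  exact map_zero (mfderiv (𝓡 n) (𝓡 n) e (e.symm y))

/-- A nonzero vector in the kernel of the matrix would have zero length. -/
theorem isUnit_det_metricMatrix (he : e ∈ IsManifold.maximalAtlas (𝓡 n) ∞ M)
    {y : EuclideanSpace ℝ (Fin n)} (hy : y ∈ e.target) : IsUnit (metricMatrix g e y).det := by
  rw [isUnit_iff_ne_zero]
  intro h
  obtain ⟨v, hv, hv0⟩ := Matrix.exists_mulVec_eq_zero_iff.2 h
  refine (chartMetric_pos g he hy (a := WithLp.toLp 2 v) fun h' => hv ?_).ne' ?_
  · simpa using h'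
  · rw [chartMetric_apply]
    refine Finset.sum_eq_zero fun i _ => ?_
    have h1 : ∑ j, metricMatrix g e y i j * v j = 0 := congrFun hv0 i
    calc _ = v i * ∑ j, metricMatrix g e y i j * v j := by
          rw [Finset.mul_sum]
          refine Finset.sum_congr rfl fun j _ => ?_
          simp only []
          ring
      _ = 0 := by rw [h1, mul_zero]

theorem contDiffOn_det {V : Type*} [NormedAddCommGroup V] [NormedSpace ℝ V] {ι : Type*} [Fintype ι]
    [DecidableEq ι] {A : V → Matrix ι ι ℝ} {s : Set V}
    (hA : ∀ i j, ContDiffOn ℝ ∞ (fun y => A y i j) s) : ContDiffOn ℝ ∞ (fun y => (A y).det) s := by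
  simp only [Matrix.det_apply']
  exact ContDiffOn.sum fun σ _ => contDiffOn_const.mul (contDiffOn_prod fun i _ => hA _ _)

/-- Cramer's rule: the entries of the inverse are quotients of determinants, hence of polynomials in
the entries of `A`. -/
theorem contDiffOn_inv_apply {V : Type*} [NormedAddCommGroup V] [NormedSpace ℝ V] {ι : Type*}
    [Fintype ι] [DecidableEq ι] {A : V → Matrix ι ι ℝ} {s : Set V}
    (hA : ∀ i j, ContDiffOn ℝ ∞ (fun y => A y i j) s) (hdet : ∀ y ∈ s, IsUnit (A y).det)
    (i j : ι) : ContDiffOn ℝ ∞ (fun y => (A y)⁻¹ i j) s := by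
  simp only [Matrix.inv_def, Matrix.smul_apply, Ring.inverse_eq_inv', Matrix.adjugate_apply,
    smul_eq_mul]
  refine ((contDiffOn_det hA).inv fun y hy => (hdet y hy).ne_zero).mul (contDiffOn_det ?_)
  -- In the matrix whose determinant is the adjugate entry, row `j` is a constant basis vector and
  -- the other rows are those of `A`.
  intro a b
  by_cases h : a = j
  · subst h
    simpa using contDiffOn_const
  · simpa [Matrix.updateRow_ne h] using hA a b

theorem contDiffOn_christoffel (he : e ∈ IsManifold.maximalAtlas (𝓡 n) ∞ M) (k i j : Fin n) :
    ContDiffOn ℝ ∞ (christoffel g e k i j) e.target := by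
  have hg := contDiffOn_metricMatrix g he
  have hd : ∀ m a b, ContDiffOn ℝ ∞ (fun y => partialDeriv m (fun z => metricMatrix g e z a b) y)
      e.target := fun m a b => contDiffOn_fderiv_apply e.open_target (hg a b) _
  unfold christoffel
  refine contDiffOn_const.mul (ContDiffOn.sum fun s _ => ?_)
  exact (contDiffOn_inv_apply hg (fun y hy => isUnit_det_metricMatrix g he hy) k s).mul
    (((hd _ _ _).add (hd _ _ _)).sub (hd _ _ _))

theorem christoffel_symm (k i j : Fin n) (y : EuclideanSpace ℝ (Fin n)) :
    christoffel g e k i j y = christoffel g e k j i y := by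
  unfold christoffel
  congr 1
  refine Finset.sum_congr rfl fun s _ => ?_
  simp only [metricMatrix_symm g (e := e) _ s j, metricMatrix_symm g (e := e) _ s i,
    metricMatrix_symm g (e := e) _ i j]
  ring

theorem contDiffOn_chartMetric (he : e ∈ IsManifold.maximalAtlas (𝓡 n) ∞ M) :
    ContDiffOn ℝ ∞ (chartMetric g e) e.target := by
  unfold chartMetric
  exact ContDiffOn.sum fun i _ => ContDiffOn.sum fun j _ =>
    (contDiffOn_metricMatrix g he i j).smul contDiffOn_const

theorem contDiffOn_chartConnection (he : e ∈ IsManifold.maximalAtlas (𝓡 n) ∞ M) :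
    ContDiffOn ℝ ∞ (chartConnection g e) e.target := by
  unfold chartConnection
  exact ContDiffOn.sum fun k _ => ContDiffOn.sum fun i _ => ContDiffOn.sum fun j _ =>
    (contDiffOn_christoffel g he k i j).smul contDiffOn_const

theorem fderiv_apply_eq_sum (h : EuclideanSpace ℝ (Fin n) → ℝ) (y a : EuclideanSpace ℝ (Fin n)) :
    fderiv ℝ h y a = ∑ m, a m * partialDeriv m h y := by
  conv_lhs => rw [← sum_smul_stdVec a]
  simp [partialDeriv]

theorem fderiv_chartMetric (he : e ∈ IsManifold.maximalAtlas (𝓡 n) ∞ M)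
    {y : EuclideanSpace ℝ (Fin n)} (hy : y ∈ e.target) (a b c : EuclideanSpace ℝ (Fin n)) :
    fderiv ℝ (chartMetric g e) y a b c
      = ∑ i, ∑ j, fderiv ℝ (fun z => metricMatrix g e z i j) y a * (b i * c j) := by
  have hd : ∀ i j, DifferentiableAt ℝ (fun z => metricMatrix g e z i j) y := fun i j =>
    ((contDiffOn_metricMatrix g he i j).contDiffAt (e.open_target.mem_nhds hy)).differentiableAt
      (by simp)
  have h : HasFDerivAt (chartMetric g e) (∑ i, ∑ j,
      (fderiv ℝ (fun z => metricMatrix g e z i j) y).smulRight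
        ((EuclideanSpace.proj (𝕜 := ℝ) i).smulRight (EuclideanSpace.proj (𝕜 := ℝ) j))) y := by
    unfold chartMetric
    exact HasFDerivAt.fun_sum fun i _ => HasFDerivAt.fun_sum fun j _ =>
      (hd i j).hasFDerivAt.smul_const _
  rw [h.fderiv]
  simp

theorem fderiv_chartConnection (he : e ∈ IsManifold.maximalAtlas (𝓡 n) ∞ M)
    {y : EuclideanSpace ℝ (Fin n)} (hy : y ∈ e.target) (a b c : EuclideanSpace ℝ (Fin n))
    (k : Fin n) :
    fderiv ℝ (chartConnection g e) y a b c k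
      = ∑ i, ∑ j, fderiv ℝ (christoffel g e k i j) y a * (b i * c j) := by
  have hd : ∀ k i j, DifferentiableAt ℝ (christoffel g e k i j) y := fun k i j =>
    ((contDiffOn_christoffel g he k i j).contDiffAt (e.open_target.mem_nhds hy)).differentiableAt
      (by simp)
  have h : HasFDerivAt (chartConnection g e) (∑ k, ∑ i, ∑ j,
      (fderiv ℝ (christoffel g e k i j) y).smulRight
        ((EuclideanSpace.proj (𝕜 := ℝ) i).smulRight
          ((EuclideanSpace.proj (𝕜 := ℝ) j).smulRight (stdVec k)))) y := by
    unfold chartConnection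
    exact HasFDerivAt.fun_sum fun k _ => HasFDerivAt.fun_sum fun i _ =>
      HasFDerivAt.fun_sum fun j _ => (hd k i j).hasFDerivAt.smul_const _
  rw [h.fderiv]
  have h : ∀ l, stdVec l k = if k = l then (1 : ℝ) else 0 := fun l => stdVec_apply l k
  simp only [sum_apply, ContinuousLinearMap.smulRight_apply, smul_apply,
    PiLp.proj_apply, WithLp.ofLp_sum, Finset.sum_apply, WithLp.ofLp_smul, Pi.smul_apply, h,
    smul_eq_mul]
  rw [Finset.sum_eq_single k]
  · simp
  · intro l _ hl
    simp [Ne.symm hl]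
  · simp

/-- The derivatives of the metric in terms of the Christoffel symbols. -/
theorem partialDeriv_metricMatrix (he : e ∈ IsManifold.maximalAtlas (𝓡 n) ∞ M)
    {y : EuclideanSpace ℝ (Fin n)} (hy : y ∈ e.target) (k i j : Fin n) :
    partialDeriv k (fun z => metricMatrix g e z i j) y
      = ∑ s, (christoffel g e s k i y * metricMatrix g e y s j
        + metricMatrix g e y i s * christoffel g e s k j y) := by
  -- Christoffel symbols with the upper index lowered: the inverse matrix cancels. In the sum of the
  -- two instances used below, all terms except `∂_k g_{ij}` cancel.
  have hlow : ∀ a b c, ∑ s, metricMatrix g e y a s * christoffel g e s b c y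
      = (1 / 2) * (partialDeriv b (fun z => metricMatrix g e z a c) y
        + partialDeriv c (fun z => metricMatrix g e z b a) y
        - partialDeriv a (fun z => metricMatrix g e z b c) y) := by
    intro a b c
    have h1 : metricMatrix g e y * (metricMatrix g e y)⁻¹ = 1 :=
      Matrix.mul_nonsing_inv _ (isUnit_det_metricMatrix g he hy)
    simp only [christoffel, Finset.mul_sum]
    rw [Finset.sum_comm]
    have h2 : ∀ r, ∑ s, metricMatrix g e y a s * (metricMatrix g e y)⁻¹ s r
        = (1 : Matrix (Fin n) (Fin n) ℝ) a r := fun r => by rw [← h1, Matrix.mul_apply]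
    calc _ = ∑ r, (∑ s, metricMatrix g e y a s * (metricMatrix g e y)⁻¹ s r) *
          ((1 / 2) * (partialDeriv b (fun z => metricMatrix g e z r c) y
            + partialDeriv c (fun z => metricMatrix g e z b r) y
            - partialDeriv r (fun z => metricMatrix g e z b c) y)) := by
          refine Finset.sum_congr rfl fun r _ => ?_
          rw [Finset.sum_mul]
          refine Finset.sum_congr rfl fun s _ => ?_
          ring
      _ = _ := by
          simp [h2, Matrix.one_apply]
  rw [Finset.sum_add_distrib, hlow]
  have h3 : ∑ s, christoffel g e s k i y * metricMatrix g e y s j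
      = ∑ s, metricMatrix g e y j s * christoffel g e s k i y :=
    Finset.sum_congr rfl fun s _ => by rw [metricMatrix_symm, mul_comm]
  rw [h3, hlow]
  simp only [metricMatrix_symm g (e := e) _ j i, metricMatrix_symm g (e := e) _ k i,
    metricMatrix_symm g (e := e) _ k j]
  ring

theorem sum_rotate {ι : Type*} [Fintype ι] (f : ι → ι → ι → ℝ) :
    ∑ j, ∑ m, ∑ s, f j m s = ∑ s, ∑ j, ∑ m, f j m s :=
  (Finset.sum_congr rfl fun _ _ => Finset.sum_comm).trans Finset.sum_comm

/-- The coordinate identity `∇g = 0` contracted with three vectors; only the order of summation has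
to be matched. -/
theorem chartMetric_compat (he : e ∈ IsManifold.maximalAtlas (𝓡 n) ∞ M)
    {y : EuclideanSpace ℝ (Fin n)} (hy : y ∈ e.target) (a b c : EuclideanSpace ℝ (Fin n)) :
    fderiv ℝ (chartMetric g e) y a b c = chartMetric g e y (chartConnection g e y a b) c
      + chartMetric g e y b (chartConnection g e y a c) := by
  rw [fderiv_chartMetric g he hy]
  simp only [fderiv_apply_eq_sum, partialDeriv_metricMatrix g he hy, chartMetric_apply,
    chartConnection_apply]
  simp only [Finset.sum_mul, Finset.mul_sum, mul_add, add_mul, Finset.sum_add_distrib]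
  congr 1
  · rw [Finset.sum_congr rfl fun i _ => sum_rotate _, Finset.sum_comm]
    refine Finset.sum_congr rfl fun s _ => ?_
    rw [← sum_rotate]
    refine Finset.sum_congr rfl fun j _ =>
      Finset.sum_congr rfl fun m _ => Finset.sum_congr rfl fun i _ => ?_
    ring
  · refine Finset.sum_congr rfl fun i _ => ?_
    rw [sum_rotate]
    refine Finset.sum_congr rfl fun s _ => ?_
    rw [Finset.sum_comm]
    refine Finset.sum_congr rfl fun m _ => Finset.sum_congr rfl fun j _ => ?_
    ring

variable (F : ∀ p : M, TangentSpace (𝓡 n) p → TangentSpace (𝓡 n) p)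

/-- The force field in the chart `e`. -/
def chartForce (e : OpenPartialHomeomorph M (EuclideanSpace ℝ (Fin n)))
    (z : EuclideanSpace ℝ (Fin n) × EuclideanSpace ℝ (Fin n)) : EuclideanSpace ℝ (Fin n) :=
  coordOfVec e (e.symm z.1) (F (e.symm z.1) (vecOfCoord e z.1 z.2))

theorem contDiffOn_chartForce (he : e ∈ IsManifold.maximalAtlas (𝓡 n) ∞ M)
    (hF : ContMDiff (𝓡 n).tangent (𝓡 n).tangent ∞
      (fun q : TangentBundle (𝓡 n) M => (⟨q.1, F q.1 q.2⟩ : TangentBundle (𝓡 n) M))) :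
    ContDiffOn ℝ ∞ (chartForce F e) (e.target ×ˢ univ) := by
  rw [← contMDiffOn_iff_contDiffOn]
  have h1 := contMDiffOn_vecOfCoord he
    (s := e.target ×ˢ (univ : Set (EuclideanSpace ℝ (Fin n))))
    contDiff_fst.contDiffOn.contMDiffOn contDiff_snd.contDiffOn.contMDiffOn (fun z hz => hz.1)
  exact contMDiffOn_coordOfVec he (hF.comp_contMDiffOn h1) fun z hz => e.map_target hz.1

/-- The bridge from the manifold to the coordinate-free theory in a domain: every chart of the
maximal atlas carries such a system. -/
theorem isLocalSystem_chart (he : e ∈ IsManifold.maximalAtlas (𝓡 n) ∞ M)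
    (hF : ContMDiff (𝓡 n).tangent (𝓡 n).tangent ∞
      (fun q : TangentBundle (𝓡 n) M => (⟨q.1, F q.1 q.2⟩ : TangentBundle (𝓡 n) M))) :
    IsLocalSystem e.target (chartMetric g e) (chartConnection g e) (chartForce F e) where
  isOpen := e.open_target
  smooth_metric := contDiffOn_chartMetric g he
  metric_symm _ _ := chartMetric_symm g _
  metric_pos _ hy _ ha := chartMetric_pos g he hy ha
  smooth_connection := contDiffOn_chartConnection g he
  connection_symm y _ a b := by
    ext k
    rw [chartConnection_apply, chartConnection_apply, Finset.sum_comm]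
    refine Finset.sum_congr rfl fun i _ => Finset.sum_congr rfl fun j _ => ?_
    rw [christoffel_symm, mul_comm (a j)]
  metric_compat _ hy := chartMetric_compat g he hy
  smooth_force := contDiffOn_chartForce F he hF

end Chart

/-! ### Agreement of index formulas with the invariant operators -/

section Chart

variable {n : ℕ} {M : Type*} [TopologicalSpace M] [ChartedSpace (EuclideanSpace ℝ (Fin n)) M]
  [IsManifold (𝓡 n) ∞ M] {e : OpenPartialHomeomorph M (EuclideanSpace ℝ (Fin n))}
  (g : Bundle.ContMDiffRiemannianMetric (𝓡 n) ∞ (EuclideanSpace ℝ (Fin n))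
    (fun p : M => TangentSpace (𝓡 n) p))
  (F : ∀ p : M, TangentSpace (𝓡 n) p → TangentSpace (𝓡 n) p)

theorem covDerivAlong_eq_cov (x V : ℝ → EuclideanSpace ℝ (Fin n)) :
    covDerivAlong g e x V = cov (chartConnection g e) x V := by
  funext t
  ext k
  simp [covDerivAlong, cov, chartConnection_apply, mul_assoc]

theorem partialDeriv_component {f : EuclideanSpace ℝ (Fin n) → EuclideanSpace ℝ (Fin n)}
    {y : EuclideanSpace ℝ (Fin n)} (hf : DifferentiableAt ℝ f y) (k m : Fin n) :
    partialDeriv m (fun z => f z k) y = fderiv ℝ f y (stdVec m) k := by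
  have h : HasFDerivAt (fun z => f z k) ((EuclideanSpace.proj (𝕜 := ℝ) k).comp (fderiv ℝ f y)) y :=
    (EuclideanSpace.proj (𝕜 := ℝ) k).hasFDerivAt.comp y hf.hasFDerivAt
  rw [partialDeriv, h.fderiv]
  rfl

theorem fderiv_component_eq_sum {f : EuclideanSpace ℝ (Fin n) → EuclideanSpace ℝ (Fin n)}
    {y : EuclideanSpace ℝ (Fin n)} (hf : DifferentiableAt ℝ f y) (a : EuclideanSpace ℝ (Fin n))
    (k : Fin n) : fderiv ℝ f y a k = ∑ m, a m * partialDeriv m (fun z => f z k) y := by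
  simp only [partialDeriv_component hf]
  conv_lhs => rw [← sum_smul_stdVec a]
  simp

/-- The four terms of the curvature are matched one by one with those of `R^k_{mij}`. Each is first
brought to the common summation order `m`, `i`, `j`, followed by the contracted index. -/
theorem curv_chart (he : e ∈ IsManifold.maximalAtlas (𝓡 n) ∞ M)
    {y : EuclideanSpace ℝ (Fin n)} (hy : y ∈ e.target) (T v w : EuclideanSpace ℝ (Fin n))
    (k : Fin n) :
    curv (chartConnection g e) y T v w k
      = ∑ m, ∑ i, ∑ j, riemann g e k m i j y * T i * v j * w m := by
  have h1 : fderiv ℝ (chartConnection g e) y T v w k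
      = ∑ m, ∑ i, ∑ j, partialDeriv i (christoffel g e k j m) y * T i * v j * w m := by
    rw [fderiv_chartConnection g he hy]
    simp only [fderiv_apply_eq_sum, Finset.sum_mul]
    rw [sum_rotate, sum_rotate]
    refine Finset.sum_congr rfl fun m _ => Finset.sum_congr rfl fun i _ =>
      Finset.sum_congr rfl fun j _ => ?_
    ring
  have h2 : fderiv ℝ (chartConnection g e) y v T w k
      = ∑ m, ∑ i, ∑ j, partialDeriv j (christoffel g e k i m) y * T i * v j * w m := by
    rw [fderiv_chartConnection g he hy]
    simp only [fderiv_apply_eq_sum, Finset.sum_mul]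
    rw [Finset.sum_comm]
    refine Finset.sum_congr rfl fun m _ => Finset.sum_congr rfl fun i _ =>
      Finset.sum_congr rfl fun j _ => ?_
    ring
  have h3 : chartConnection g e y T (chartConnection g e y v w) k
      = ∑ m, ∑ i, ∑ j, ∑ a,
        christoffel g e k i a y * christoffel g e a j m y * T i * v j * w m := by
    simp only [chartConnection_apply, Finset.mul_sum]
    rw [Finset.sum_congr rfl fun i _ => sum_rotate _, Finset.sum_comm]
    refine Finset.sum_congr rfl fun m _ => Finset.sum_congr rfl fun i _ => ?_
    rw [Finset.sum_comm]
    refine Finset.sum_congr rfl fun j _ => Finset.sum_congr rfl fun a _ => ?_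
    ring
  have h4 : chartConnection g e y v (chartConnection g e y T w) k
      = ∑ m, ∑ i, ∑ j, ∑ a,
        christoffel g e k j a y * christoffel g e a i m y * T i * v j * w m := by
    simp only [chartConnection_apply, Finset.mul_sum]
    rw [Finset.sum_congr rfl fun i _ => sum_rotate _, Finset.sum_comm]
    refine Finset.sum_congr rfl fun m _ => ?_
    rw [sum_rotate]
    refine Finset.sum_congr rfl fun i _ => Finset.sum_congr rfl fun j _ =>
      Finset.sum_congr rfl fun a _ => ?_
    ring
  simp only [curv, PiLp.add_apply, PiLp.sub_apply, h1, h2, h3, h4, riemann,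
    ← Finset.sum_sub_distrib, ← Finset.sum_add_distrib]
  refine Finset.sum_congr rfl fun m _ => Finset.sum_congr rfl fun i _ =>
    Finset.sum_congr rfl fun j _ => ?_
  rw [add_mul, add_mul, add_mul, Finset.sum_mul, Finset.sum_mul, Finset.sum_mul]
  congr 1
  · ring
  · refine Finset.sum_congr rfl fun a _ => ?_
    ring

/-- The equation of variations in local coordinates. -/
theorem variationRhs_chart (he : e ∈ IsManifold.maximalAtlas (𝓡 n) ∞ M)
    (hF : ContMDiff (𝓡 n).tangent (𝓡 n).tangent ∞
      (fun q : TangentBundle (𝓡 n) M => (⟨q.1, F q.1 q.2⟩ : TangentBundle (𝓡 n) M)))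
    {y : EuclideanSpace ℝ (Fin n)} (hy : y ∈ e.target) (v T w : EuclideanSpace ℝ (Fin n))
    (k : Fin n) :
    variationRhs (chartConnection g e) (chartForce F e) y v T w k =
      - (∑ m, ∑ i, ∑ j, riemann g e k m i j y * T i * v j * v m)
      + ∑ m, w m * velocityGrad F e m k y v
      + ∑ m, T m * spaceGrad g F e m k y v := by
  have hd : DifferentiableAt ℝ (chartForce F e) (y, v) :=
    ((isLocalSystem_chart g F he hF).contDiffAt_force hy v).differentiableAt (by simp)
  have hd1 : HasFDerivAt (fun y' => chartForce F e (y', v)) ((fderiv ℝ (chartForce F e) (y, v)).comp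
      (ContinuousLinearMap.inl ℝ _ _)) y :=
    HasFDerivAt.comp (f := fun y' => (y', v)) y hd.hasFDerivAt (hasFDerivAt_prodMk_left y v)
  have hd2 : HasFDerivAt (fun w' => chartForce F e (y, w')) ((fderiv ℝ (chartForce F e) (y, v)).comp
      (ContinuousLinearMap.inr ℝ _ _)) v :=
    HasFDerivAt.comp (f := fun w' => (y, w')) v hd.hasFDerivAt (hasFDerivAt_prodMk_right y v)
  have hx : ∀ a, fderiv ℝ (chartForce F e) (y, v) (a, 0) k
      = ∑ m, a m * partialDeriv m (fun y' => forceCoord F e k y' v) y := by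
    intro a
    have h := fderiv_component_eq_sum hd1.differentiableAt a k
    rw [hd1.fderiv] at h
    exact h
  have hv : ∀ a, fderiv ℝ (chartForce F e) (y, v) (0, a) k
      = ∑ m, a m * velocityGrad F e m k y v := by
    intro a
    have h := fderiv_component_eq_sum hd2.differentiableAt a k
    rw [hd2.fderiv] at h
    exact h
  have h1 : chartConnection g e y T (chartForce F e (y, v)) k
      = ∑ m, T m * ∑ i, christoffel g e k m i y * forceCoord F e i y v := by
    simp only [chartConnection_apply, Finset.mul_sum]
    refine Finset.sum_congr rfl fun m _ => Finset.sum_congr rfl fun i _ => ?_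
    change _ * (_ * forceCoord F e i y v) = _
    ring
  have h2 : ∑ m, chartConnection g e y T v m * velocityGrad F e m k y v
      = ∑ m, T m * ∑ i, ∑ j, christoffel g e i m j y * v j * velocityGrad F e i k y v := by
    simp only [chartConnection_apply, Finset.mul_sum, Finset.sum_mul]
    rw [Finset.sum_comm]
    refine Finset.sum_congr rfl fun m _ => Finset.sum_congr rfl fun i _ =>
      Finset.sum_congr rfl fun j _ => ?_
    ring
  simp only [variationRhs, PiLp.add_apply, PiLp.sub_apply, PiLp.neg_apply, hx, hv, h1, h2,
    curv_chart g he hy, spaceGrad, mul_add, mul_sub, Finset.sum_add_distrib,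
    Finset.sum_sub_distrib]

end Chart

/-! ### Trajectories, variations and shifts in a chart -/

section Transfer

variable {n : ℕ} {M : Type*} [TopologicalSpace M] [ChartedSpace (EuclideanSpace ℝ (Fin n)) M]
  [IsManifold (𝓡 n) ∞ M] {e : OpenPartialHomeomorph M (EuclideanSpace ℝ (Fin n))}
  {g : Bundle.ContMDiffRiemannianMetric (𝓡 n) ∞ (EuclideanSpace ℝ (Fin n))
    (fun p : M => TangentSpace (𝓡 n) p)}
  {F : ∀ p : M, TangentSpace (𝓡 n) p → TangentSpace (𝓡 n) p}

/-- Stated in the total space because `e.symm (e p)` and `p` are only propositionally equal, so the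
two vectors lie in formally different fibres. -/
theorem mk_vecOfCoord_coordOfVec (he : e ∈ IsManifold.maximalAtlas (𝓡 n) ∞ M) {p : M}
    (hp : p ∈ e.source) (a : TangentSpace (𝓡 n) p) :
    (⟨e.symm (e p), vecOfCoord e (e p) (coordOfVec e p a)⟩ : TangentBundle (𝓡 n) M) = ⟨p, a⟩ := by
  obtain ⟨y, hy, rfl⟩ : ∃ y ∈ e.target, e.symm y = p := ⟨e p, e.map_source hp, e.left_inv hp⟩
  rw [e.right_inv hy, vecOfCoord_coordOfVec he hy]

theorem coordOfVec_congr {p q : M} {a : TangentSpace (𝓡 n) p} {b : TangentSpace (𝓡 n) q}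
    (h : (⟨p, a⟩ : TangentBundle (𝓡 n) M) = ⟨q, b⟩) : coordOfVec e p a = coordOfVec e q b :=
  congrArg (fun z : TangentBundle (𝓡 n) M => coordOfVec e z.1 z.2) h

theorem coordOfVec_mfderiv (he : e ∈ IsManifold.maximalAtlas (𝓡 n) ∞ M) {V : Type*}
    [NormedAddCommGroup V] [NormedSpace ℝ V] {f : V → M} {q : V}
    (hf : MDifferentiableAt 𝓘(ℝ, V) (𝓡 n) f q) (hq : f q ∈ e.source) (a : V) :
    coordOfVec e (f q) (mfderiv 𝓘(ℝ, V) (𝓡 n) f q a) = fderiv ℝ (fun z => e (f z)) q a := by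
  have h := mfderiv_comp q ((mdifferentiable_of_mem_maximalAtlas he).mdifferentiableAt hq) hf
  rw [← mfderiv_eq_fderiv]
  exact (DFunLike.congr_fun h a).symm

theorem coordOfVec_velocity (he : e ∈ IsManifold.maximalAtlas (𝓡 n) ∞ M) {γ : ℝ → M} {t : ℝ}
    (hγ : MDifferentiableAt 𝓘(ℝ, ℝ) (𝓡 n) γ t) (ht : γ t ∈ e.source) :
    coordOfVec e (γ t) (velocity γ t) = deriv (fun s => e (γ s)) t :=
  (coordOfVec_mfderiv he hγ ht 1).trans fderiv_apply_one_eq_deriv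

namespace IsTrajectory

variable {J : Set ℝ} {γ : ℝ → M}

theorem isOpen_chart (h : IsTrajectory g F J γ)
    (e : OpenPartialHomeomorph M (EuclideanSpace ℝ (Fin n))) : IsOpen (J ∩ γ ⁻¹' e.source) :=
  h.smooth.continuousOn.isOpen_inter_preimage h.isOpen e.open_source

theorem contDiffOn_chart (h : IsTrajectory g F J γ)
    (he : e ∈ IsManifold.maximalAtlas (𝓡 n) ∞ M) :
    ContDiffOn ℝ ∞ (fun s => e (γ s)) (J ∩ γ ⁻¹' e.source) := by
  rw [← contMDiffOn_iff_contDiffOn]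
  exact (contMDiffOn_of_mem_maximalAtlas he).comp (h.smooth.mono inter_subset_left)
    fun s hs => hs.2

theorem mapsTo_chart (e : OpenPartialHomeomorph M (EuclideanSpace ℝ (Fin n))) (γ : ℝ → M) :
    MapsTo (fun s => e (γ s)) (J ∩ γ ⁻¹' e.source) e.target :=
  fun _ hs => e.map_source hs.2

theorem newton_chart (h : IsTrajectory g F J γ) (he : e ∈ IsManifold.maximalAtlas (𝓡 n) ∞ M)
    {s : ℝ} (hs : s ∈ J ∩ γ ⁻¹' e.source) :
    cov (chartConnection g e) (fun s => e (γ s)) (deriv fun s => e (γ s)) s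
      = chartForce F e (e (γ s), deriv (fun s => e (γ s)) s) := by
  rw [← covDerivAlong_eq_cov]
  ext k
  exact h.newton e he s hs.1 hs.2 k

theorem mdifferentiableAt (h : IsTrajectory g F J γ) {t : ℝ} (ht : t ∈ J) :
    MDifferentiableAt 𝓘(ℝ, ℝ) (𝓡 n) γ t :=
  (h.smooth.contMDiffAt (h.isOpen.mem_nhds ht)).mdifferentiableAt (by simp)

theorem deviation_eq (h : IsTrajectory g F J γ) (he : e ∈ IsManifold.maximalAtlas (𝓡 n) ∞ M)
    (τ : ∀ t, TangentSpace (𝓡 n) (γ t)) {t : ℝ} (ht : t ∈ J ∩ γ ⁻¹' e.source) :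
    deviation g γ τ t = chartMetric g e (e (γ t)) (deriv (fun s => e (γ s)) t)
      (coordOfVec e (γ t) (τ t)) := by
  rw [deviation, inner_eq_chartMetric g he ht.2,
    coordOfVec_velocity he (h.mdifferentiableAt ht.1) ht.2]

end IsTrajectory

namespace IsVariation

variable {J : Set ℝ} {γ : ℝ → M} {τ : ∀ t, TangentSpace (𝓡 n) (γ t)}

theorem contDiffOn_chart (hτ : IsVariation g F J γ τ)
    (he : e ∈ IsManifold.maximalAtlas (𝓡 n) ∞ M) :
    ContDiffOn ℝ ∞ (fun s => coordOfVec e (γ s) (τ s)) (J ∩ γ ⁻¹' e.source) := by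
  rw [← contMDiffOn_iff_contDiffOn]
  exact contMDiffOn_coordOfVec he (hτ.smooth.mono inter_subset_left) fun s hs => hs.2

theorem cov_cov_chart (hτ : IsVariation g F J γ τ) (he : e ∈ IsManifold.maximalAtlas (𝓡 n) ∞ M)
    (hF : ContMDiff (𝓡 n).tangent (𝓡 n).tangent ∞
      (fun q : TangentBundle (𝓡 n) M => (⟨q.1, F q.1 q.2⟩ : TangentBundle (𝓡 n) M)))
    {t : ℝ} (ht : t ∈ J ∩ γ ⁻¹' e.source) :
    cov (chartConnection g e) (fun s => e (γ s)) (cov (chartConnection g e) (fun s => e (γ s))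
        fun s => coordOfVec e (γ s) (τ s)) t
      = variationRhs (chartConnection g e) (chartForce F e) (e (γ t))
        (deriv (fun s => e (γ s)) t) (coordOfVec e (γ t) (τ t))
        (cov (chartConnection g e) (fun s => e (γ s)) (fun s => coordOfVec e (γ s) (τ s)) t) := by
  ext k
  rw [variationRhs_chart g F he hF (e.map_source ht.2), ← covDerivAlong_eq_cov,
    ← covDerivAlong_eq_cov]
  exact hτ.equation e he t ht.1 ht.2 k

/-- Near `t` the function of deviation coincides with its expression in the chart, so both
derivatives can be computed there. -/
theorem hasDerivAt_deviation (hτ : IsVariation g F J γ τ) (h : IsTrajectory g F J γ)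
    (he : e ∈ IsManifold.maximalAtlas (𝓡 n) ∞ M)
    (hF : ContMDiff (𝓡 n).tangent (𝓡 n).tangent ∞
      (fun q : TangentBundle (𝓡 n) M => (⟨q.1, F q.1 q.2⟩ : TangentBundle (𝓡 n) M)))
    {t : ℝ} (ht : t ∈ J ∩ γ ⁻¹' e.source) :
    HasDerivAt (deviation g γ τ)
      (deviationDeriv (chartMetric g e) (chartForce F e) (e (γ t))
        (deriv (fun s => e (γ s)) t) (coordOfVec e (γ t) (τ t))
        (cov (chartConnection g e) (fun s => e (γ s)) (fun s => coordOfVec e (γ s) (τ s)) t)) t ∧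
    HasDerivAt (deriv (deviation g γ τ))
      (deviationDeriv2 (chartMetric g e) (chartConnection g e) (chartForce F e) (e (γ t))
        (deriv (fun s => e (γ s)) t) (coordOfVec e (γ t) (τ t))
        (cov (chartConnection g e) (fun s => e (γ s)) (fun s => coordOfVec e (γ s) (τ s)) t)) t := by
  have hS := isLocalSystem_chart g F he hF
  have hI := h.isOpen_chart e
  have heq : deviation g γ τ =ᶠ[𝓝 t] fun s => chartMetric g e (e (γ s))
      (deriv (fun s => e (γ s)) s) (coordOfVec e (γ s) (τ s)) :=
    (hI.mem_nhds ht |> mem_of_superset) fun s hs => h.deviation_eq he τ hs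
  exact ⟨(hS.deriv_deviation hI (h.contDiffOn_chart he) (hτ.contDiffOn_chart he)
      (IsTrajectory.mapsTo_chart e γ) (fun s hs => h.newton_chart he hs) ht).congr_of_eventuallyEq
      heq,
    (hS.deriv2_deviation hI (h.contDiffOn_chart he) (hτ.contDiffOn_chart he)
      (IsTrajectory.mapsTo_chart e γ) (fun s hs => h.newton_chart he hs) ht
      (hτ.cov_cov_chart he hF ht)).congr_of_eventuallyEq heq.deriv⟩

end IsVariation

/-- The vector of variation of the shift `f` in the direction `α` of the parameter space. -/
def shiftVariationAlong (f : M → ℝ → M) (X : EuclideanSpace ℝ (Fin (n - 1)) → M)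
    (u α : EuclideanSpace ℝ (Fin (n - 1))) (t : ℝ) : TangentSpace (𝓡 n) (f (X u) t) :=
  mfderiv (𝓡 (n - 1)) (𝓡 n) (fun u' => f (X u') t) u α

namespace IsShift

variable {S : Set M} {N : ∀ p : M, TangentSpace (𝓡 n) p} {ν : M → ℝ} {ε : ℝ} {f : M → ℝ → M}
  {W : Set (EuclideanSpace ℝ (Fin (n - 1)))} {X : EuclideanSpace ℝ (Fin (n - 1)) → M}

/-- The part of the domain of the shift that is mapped into the domain of the chart `e`. -/
def chartDomain (W : Set (EuclideanSpace ℝ (Fin (n - 1))))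
    (X : EuclideanSpace ℝ (Fin (n - 1)) → M) (ε : ℝ) (f : M → ℝ → M)
    (e : OpenPartialHomeomorph M (EuclideanSpace ℝ (Fin n))) :
    Set (EuclideanSpace ℝ (Fin (n - 1)) × ℝ) :=
  (W ×ˢ Ioo (-ε) ε) ∩ (fun q => f (X q.1) q.2) ⁻¹' e.source

theorem isOpen_chartDomain (hf : IsShift g F S N ν ε f) (hX : IsLocalParam S W X)
    (e : OpenPartialHomeomorph M (EuclideanSpace ℝ (Fin n))) : IsOpen (chartDomain W X ε f e) :=
  (hf.smooth W X hX).continuousOn.isOpen_inter_preimage (hX.isOpen.prod isOpen_Ioo) e.open_source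

theorem contDiffOn_chart (hf : IsShift g F S N ν ε f) (hX : IsLocalParam S W X)
    (he : e ∈ IsManifold.maximalAtlas (𝓡 n) ∞ M) :
    ContDiffOn ℝ ∞ (fun q : EuclideanSpace ℝ (Fin (n - 1)) × ℝ => e (f (X q.1) q.2))
      (chartDomain W X ε f e) := by
  have h := (contMDiffOn_of_mem_maximalAtlas he).comp
    ((hf.smooth W X hX).mono (inter_subset_left (t := (fun q => f (X q.1) q.2) ⁻¹' e.source)))
    fun s hs => hs.2
  rw [← contMDiffOn_iff_contDiffOn, modelWithCornersSelf_prod, ← chartedSpaceSelf_prod]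
  exact h

theorem _root_.NewtonianShift.IsLocalParam.mem (hX : IsLocalParam S W X)
    {u : EuclideanSpace ℝ (Fin (n - 1))} (hu : u ∈ W) : X u ∈ S := by
  obtain ⟨U, -, hU⟩ := hX.isOpen_image W Subset.rfl hX.isOpen
  exact (hU ▸ mem_image_of_mem X hu : X u ∈ S ∩ U).1

theorem mdifferentiableAt_slice (hf : IsShift g F S N ν ε f) (hX : IsLocalParam S W X)
    {u : EuclideanSpace ℝ (Fin (n - 1))} (hu : u ∈ W) {t : ℝ} (ht : t ∈ Ioo (-ε) ε) :
    MDifferentiableAt (𝓡 (n - 1)) (𝓡 n) (fun u' => f (X u') t) u := by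
  have h1 : ContMDiffAt (𝓡 (n - 1)) ((𝓡 (n - 1)).prod 𝓘(ℝ, ℝ)) ∞
      (fun u' : EuclideanSpace ℝ (Fin (n - 1)) => (u', t)) u :=
    contMDiffAt_id.prodMk contMDiffAt_const
  exact (((hf.smooth W X hX).contMDiffAt ((hX.isOpen.prod isOpen_Ioo).mem_nhds ⟨hu, ht⟩)).comp u
    h1).mdifferentiableAt (by simp)

theorem coordOfVec_shiftVariationAlong (hf : IsShift g F S N ν ε f) (hX : IsLocalParam S W X)
    (he : e ∈ IsManifold.maximalAtlas (𝓡 n) ∞ M) {u : EuclideanSpace ℝ (Fin (n - 1))} {t : ℝ}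
    (h : (u, t) ∈ chartDomain W X ε f e) (α : EuclideanSpace ℝ (Fin (n - 1))) :
    coordOfVec e (f (X u) t) (shiftVariationAlong f X u α t)
      = fderiv ℝ (fun q : EuclideanSpace ℝ (Fin (n - 1)) × ℝ => e (f (X q.1) q.2)) (u, t) (α, 0) := by
  have h1 := coordOfVec_mfderiv he (hf.mdifferentiableAt_slice hX h.1.1 h.1.2) h.2 α
  refine h1.trans ?_
  have hd : DifferentiableAt ℝ (fun q : EuclideanSpace ℝ (Fin (n - 1)) × ℝ => e (f (X q.1) q.2))
      (u, t) :=
    ((hf.contDiffOn_chart hX he).contDiffAt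
      ((hf.isOpen_chartDomain hX e).mem_nhds h)).differentiableAt (by simp)
  have h2 := HasFDerivAt.comp (f := fun u' : EuclideanSpace ℝ (Fin (n - 1)) => (u', t)) u
    hd.hasFDerivAt (hasFDerivAt_prodMk_left u t)
  exact DFunLike.congr_fun h2.fderiv α

theorem newton_chart (hf : IsShift g F S N ν ε f) (hX : IsLocalParam S W X)
    (he : e ∈ IsManifold.maximalAtlas (𝓡 n) ∞ M) (q : EuclideanSpace ℝ (Fin (n - 1)) × ℝ)
    (hq : q ∈ chartDomain W X ε f e) :
    cov (chartConnection g e) (fun s => e (f (X q.1) s)) (deriv fun s => e (f (X q.1) s)) q.2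
      = chartForce F e (e (f (X q.1) q.2), deriv (fun s => e (f (X q.1) s)) q.2) :=
  (hf.trajectory _ (hX.mem hq.1.1)).newton_chart he ⟨hq.1.2, hq.2⟩

/-- In a chart this field is the parameter derivative of a smooth family of trajectories, so it is
smooth and `cov_cov_eq_variationRhs` applies. -/
theorem isVariation (hf : IsShift g F S N ν ε f) (hX : IsLocalParam S W X)
    (hF : ContMDiff (𝓡 n).tangent (𝓡 n).tangent ∞
      (fun q : TangentBundle (𝓡 n) M => (⟨q.1, F q.1 q.2⟩ : TangentBundle (𝓡 n) M)))
    {u : EuclideanSpace ℝ (Fin (n - 1))} (hu : u ∈ W) (α : EuclideanSpace ℝ (Fin (n - 1))) :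
    IsVariation g F (Ioo (-ε) ε) (f (X u)) (shiftVariationAlong f X u α) := by
  have htraj := hf.trajectory _ (hX.mem hu)
  constructor
  · intro t ht
    set e := chartAt (EuclideanSpace ℝ (Fin n)) (f (X u) t) with he'
    have he : e ∈ IsManifold.maximalAtlas (𝓡 n) ∞ M := IsManifold.chart_mem_maximalAtlas _
    have hmem : t ∈ Ioo (-ε) ε ∩ f (X u) ⁻¹' e.source := ⟨ht, mem_chart_source _ _⟩
    have hopen := htraj.isOpen_chart e
    refine (ContMDiffOn.contMDiffAt (s := Ioo (-ε) ε ∩ f (X u) ⁻¹' e.source) ?_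
      (hopen.mem_nhds hmem)).contMDiffWithinAt
    have hx := htraj.contDiffOn_chart he
    have hT : ContDiffOn ℝ ∞ (fun s => fderiv ℝ
        (fun q : EuclideanSpace ℝ (Fin (n - 1)) × ℝ => e (f (X q.1) q.2)) (u, s) (α, 0))
        (Ioo (-ε) ε ∩ f (X u) ⁻¹' e.source) :=
      (contDiffOn_fderiv_apply (hf.isOpen_chartDomain hX e) (hf.contDiffOn_chart hX he) (α, 0)).comp
        (contDiff_prodMk_right u).contDiffOn fun s hs => ⟨⟨hu, hs.1⟩, hs.2⟩
    refine (contMDiffOn_vecOfCoord he hx.contMDiffOn hT.contMDiffOn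
      (IsTrajectory.mapsTo_chart e _)).congr fun s hs => ?_
    rw [← hf.coordOfVec_shiftVariationAlong hX he ⟨⟨hu, hs.1⟩, hs.2⟩ α,
      mk_vecOfCoord_coordOfVec he hs.2]
  · intro e he t ht hte
    intro x v T DT k
    have hO := hf.isOpen_chartDomain hX e
    have hmem : (u, t) ∈ chartDomain W X ε f e := ⟨⟨hu, ht⟩, hte⟩
    have hTeq : T =ᶠ[𝓝 t] fun s => fderiv ℝ
        (fun q : EuclideanSpace ℝ (Fin (n - 1)) × ℝ => e (f (X q.1) q.2)) (u, s) (α, 0) := by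
      filter_upwards [eventually_slice hO hmem] with s hs
      exact hf.coordOfVec_shiftVariationAlong hX he hs α
    -- The covariant derivative is taken twice, so the first ones must agree on a neighbourhood of
    -- `t`, not only at `t`.
    have hDT : cov (chartConnection g e) x T =ᶠ[𝓝 t] cov (chartConnection g e) x (fun s => fderiv ℝ
        (fun q : EuclideanSpace ℝ (Fin (n - 1)) × ℝ => e (f (X q.1) q.2)) (u, s) (α, 0)) := by
      filter_upwards [hTeq.eventuallyEq_nhds] with s hs
      rw [cov, cov, hs.deriv_eq, hs.eq_of_nhds]
    have h := cov_cov_eq_variationRhs (isLocalSystem_chart g F he hF) hO (hf.contDiffOn_chart hX he)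
      (fun q hq => e.map_source hq.2) (hf.newton_chart hX he) hmem α
    have h1 : cov (chartConnection g e) x (cov (chartConnection g e) x T) t
        = variationRhs (chartConnection g e) (chartForce F e) (x t) (v t) (T t)
          (cov (chartConnection g e) x T t) := by
      rw [cov, hDT.deriv_eq, hDT.eq_of_nhds, hTeq.eq_of_nhds]
      exact h
    have h2 := (congrArg (fun w : EuclideanSpace ℝ (Fin n) => w k) h1).trans
      (variationRhs_chart g F he hF (e.map_source hte) _ _ _ k)
    simp only [DT, covDerivAlong_eq_cov]
    exact h2

end IsShift

end Transfer

/-! ### Complete normality implies strong normality -/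

section Normality

variable {n : ℕ} {M : Type*} [TopologicalSpace M] [ChartedSpace (EuclideanSpace ℝ (Fin n)) M]
  [IsManifold (𝓡 n) ∞ M]
  {g : Bundle.ContMDiffRiemannianMetric (𝓡 n) ∞ (EuclideanSpace ℝ (Fin n))
    (fun p : M => TangentSpace (𝓡 n) p)}
  {F : ∀ p : M, TangentSpace (𝓡 n) p → TangentSpace (𝓡 n) p}

theorem IsVariation.differentiableAt_deviation {J : Set ℝ} {γ : ℝ → M}
    {τ : ∀ t, TangentSpace (𝓡 n) (γ t)} (hτ : IsVariation g F J γ τ) (h : IsTrajectory g F J γ)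
    (hF : ContMDiff (𝓡 n).tangent (𝓡 n).tangent ∞
      (fun q : TangentBundle (𝓡 n) M => (⟨q.1, F q.1 q.2⟩ : TangentBundle (𝓡 n) M)))
    {t : ℝ} (ht : t ∈ J) :
    DifferentiableAt ℝ (deviation g γ τ) t ∧ DifferentiableAt ℝ (deriv (deviation g γ τ)) t := by
  have := hτ.hasDerivAt_deviation h (IsManifold.chart_mem_maximalAtlas (γ t)) hF
    ⟨ht, mem_chart_source _ _⟩
  exact ⟨this.1.differentiableAt, this.2.differentiableAt⟩

namespace IsShift

variable {S : Set M} {N : ∀ p : M, TangentSpace (𝓡 n) p} {ν : M → ℝ} {ε : ℝ} {f : M → ℝ → M}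
  {W : Set (EuclideanSpace ℝ (Fin (n - 1)))} {X : EuclideanSpace ℝ (Fin (n - 1)) → M}

theorem zero_mem (hf : IsShift g F S N ν ε f) : (0 : ℝ) ∈ Ioo (-ε) ε :=
  ⟨neg_lt_zero.2 hf.pos, hf.pos⟩

theorem apply_zero (hf : IsShift g F S N ν ε f) {p : M} (hp : p ∈ S) : f p 0 = p :=
  congrArg (fun z : TangentBundle (𝓡 n) M => z.1) (hf.initial p hp)

/-- The trajectories of shift are orthogonal to `S` at the initial instant of time. -/
theorem deviation_zero (hf : IsShift g F S N ν ε f) (hN : IsUnitNormalField g S N)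
    (hX : IsLocalParam S W X) {u : EuclideanSpace ℝ (Fin (n - 1))} (hu : u ∈ W)
    (α : EuclideanSpace ℝ (Fin (n - 1))) :
    deviation g (f (X u)) (shiftVariationAlong f X u α) 0 = 0 := by
  set e := chartAt (EuclideanSpace ℝ (Fin n)) (X u)
  have he : e ∈ IsManifold.maximalAtlas (𝓡 n) ∞ M := IsManifold.chart_mem_maximalAtlas _
  have hs : X u ∈ e.source := mem_chart_source _ _
  have h0 : f (X u) 0 = X u := hf.apply_zero (hX.mem hu)
  have hs0 : f (X u) 0 ∈ e.source := by rw [h0]; exact hs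
  have hT : coordOfVec e (f (X u) 0) (shiftVariationAlong f X u α 0)
      = coordOfVec e (X u) (mfderiv (𝓡 (n - 1)) (𝓡 n) X u α) := by
    have hXd : MDifferentiableAt (𝓡 (n - 1)) (𝓡 n) X u :=
      (hX.smooth.contMDiffAt (hX.isOpen.mem_nhds hu)).mdifferentiableAt (by simp)
    refine (coordOfVec_mfderiv he (hf.mdifferentiableAt_slice hX hu hf.zero_mem) hs0 α).trans
      (Eq.trans ?_ (coordOfVec_mfderiv he hXd hs α).symm)
    -- At `t = 0` the shift is the identity on the hypersurface, so the vectors of variation are the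
    -- tangent vectors `dX(α)`.
    refine DFunLike.congr_fun (Filter.EventuallyEq.fderiv_eq ?_) α
    filter_upwards [hX.isOpen.mem_nhds hu] with u' hu'
    rw [hf.apply_zero (hX.mem hu')]
  have hV : coordOfVec e (f (X u) 0) (velocity (f (X u)) 0)
      = coordOfVec e (X u) (ν (X u) • N (X u)) := coordOfVec_congr (hf.initial _ (hX.mem hu))
  rw [deviation, inner_eq_chartMetric g he hs0, hT, hV, h0, ← inner_eq_chartMetric g he hs, map_smul,
    smul_apply, (hN.unitNormal _ (hX.mem hu)).2 _ ⟨W, X, hX, u, hu, α, rfl⟩, smul_zero]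

end IsShift

/-- The piece, normal field, speed and shift given by additional normality already work: each `φ_k`
solves a linear homogeneous equation on `(-ε, ε)` with zero Cauchy data. -/
theorem CompleteNormality.strongNormality (h : CompleteNormality g F)
    (hF : ContMDiff (𝓡 n).tangent (𝓡 n).tangent ∞
      (fun q : TangentBundle (𝓡 n) M => (⟨q.1, F q.1 q.2⟩ : TangentBundle (𝓡 n) M))) :
    StrongNormality g F := by
  intro S hS p₀ hp₀ m₀ hm₀ ν₀ hν₀
  obtain ⟨S', hS', hp, hcl, N, hN, hNp, ν, hν, hνp, ε, f, hf, hdev⟩ :=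
    h.2 S hS p₀ hp₀ m₀ hm₀ ν₀ hν₀
  refine ⟨S', hS', hp, hcl, N, hN, hNp, ν, hν, hνp, ε, f, hf, ?_⟩
  intro W X hX u hu t ht k
  have htraj := hf.trajectory _ (hX.mem hu)
  have hvar := hf.isVariation hX hF hu (stdVec k)
  obtain ⟨A, B, hA, hB, hAB⟩ := h.1 _ _ htraj
  refine eq_zero_of_linear_ode2 (φ := deviation g (f (X u)) (shiftVariationAlong f X u (stdVec k)))
    (φ' := deriv (deviation g (f (X u)) (shiftVariationAlong f X u (stdVec k)))) hA hB
    (fun s hs => (hvar.differentiableAt_deviation htraj hF hs).1.hasDerivAt) (fun s hs => ?_)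
    (hf.deviation_zero hN hX hu _) (hdev W X hX u hu k) ht
  rw [← hAB _ hvar s hs]
  exact (hvar.differentiableAt_deviation htraj hF hs).2.hasDerivAt

theorem StrongNormality.additionalNormality (h : StrongNormality g F) :
    AdditionalNormality g F := by
  intro S hS p₀ hp₀ m₀ hm₀ ν₀ hν₀
  obtain ⟨S', hS', hp, hcl, N, hN, hNp, ν, hν, hνp, ε, f, hf, hnorm⟩ := h S hS p₀ hp₀ m₀ hm₀ ν₀ hν₀
  refine ⟨S', hS', hp, hcl, N, hN, hNp, ν, hν, hνp, ε, f, hf, fun W X hX u hu k => ?_⟩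
  have h0 : shiftDeviation g f X u k =ᶠ[𝓝 0] fun _ => (0 : ℝ) := by
    filter_upwards [isOpen_Ioo.mem_nhds hf.zero_mem] with t ht using hnorm W X hX u hu t ht k
  rw [h0.deriv_eq, deriv_const]

/-- All functions of deviation of a normal shift vanish. -/
theorem IsNormalShift.deviation_eq_zero {S : Set M} {ε : ℝ} {f : M → ℝ → M}
    (h : IsNormalShift g S ε f) {W : Set (EuclideanSpace ℝ (Fin (n - 1)))}
    {X : EuclideanSpace ℝ (Fin (n - 1)) → M} (hX : IsLocalParam S W X)
    {u : EuclideanSpace ℝ (Fin (n - 1))} (hu : u ∈ W) (α : EuclideanSpace ℝ (Fin (n - 1))) {t : ℝ}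
    (ht : t ∈ Ioo (-ε) ε) : deviation g (f (X u)) (shiftVariationAlong f X u α) t = 0 := by
  let L : EuclideanSpace ℝ (Fin (n - 1)) →L[ℝ] ℝ :=
    (g.inner (f (X u) t) (velocity (f (X u)) t)).comp
      (mfderiv (𝓡 (n - 1)) (𝓡 n) (fun u' => f (X u') t) u :
        EuclideanSpace ℝ (Fin (n - 1)) →L[ℝ] TangentSpace (𝓡 n) (f (X u) t))
  change L α = 0
  rw [← sum_smul_stdVec α, map_sum]
  refine Finset.sum_eq_zero fun k _ => ?_
  rw [map_smul, show L (stdVec k) = 0 from h W X hX u hu t ht k, smul_zero]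

end Normality

/-! ### Strong normality implies pointwise weak normality -/

/-! ### Hyperplanes, symmetric forms and differentiated orthogonality -/

section LinearAlgebra

variable {V : Type*} [NormedAddCommGroup V] [NormedSpace ℝ V]

/-- A hyperplane is parametrized by a linear map which has a left inverse. -/
theorem exists_hyperplane_param {m : ℕ} {E : Type*} [NormedAddCommGroup E] [NormedSpace ℝ E]
    [FiniteDimensional ℝ E] (hm : Module.finrank ℝ E = m + 1) (φ : E →L[ℝ] ℝ) {v : E}
    (hv : φ v ≠ 0) :
    ∃ (L : EuclideanSpace ℝ (Fin m) →L[ℝ] E) (π : E →L[ℝ] EuclideanSpace ℝ (Fin m)),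
      (∀ α, φ (L α) = 0) ∧ (∀ α, π (L α) = α) ∧ π v = 0 ∧
      ∀ z, L (π z) = z - (φ z / φ v) • v := by
  set K : Submodule ℝ E := LinearMap.ker φ.toLinearMap with hK
  have hKdim : Module.finrank ℝ K = m := by
    have h1 := LinearMap.finrank_range_add_finrank_ker φ.toLinearMap
    have h2 : LinearMap.range φ.toLinearMap = ⊤ :=
      LinearMap.range_eq_top.2 (LinearMap.surjective fun h => hv (by
        simpa using DFunLike.congr_fun h v))
    rw [h2, finrank_top, Module.finrank_self, hm] at h1
    change 1 + Module.finrank ℝ K = m + 1 at h1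
    omega
  let L₀ : EuclideanSpace ℝ (Fin m) ≃ₗ[ℝ] K :=
    LinearEquiv.ofFinrankEq _ _ (by rw [hKdim]; simp)
  -- The projection onto the hyperplane `ker φ` along `v`; `π` is this projection read in the
  -- coordinates `L₀`.
  let p : E →ₗ[ℝ] E := LinearMap.id - (φ.toLinearMap.smulRight ((φ v)⁻¹ • v))
  have hp : ∀ z, p z = z - (φ z / φ v) • v := fun z => by
    simp [p, smul_smul, div_eq_mul_inv]
  have hpK : ∀ z, p z ∈ K := fun z => by
    rw [hp, hK, LinearMap.mem_ker]
    simp [hv]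
  let π₀ : E →ₗ[ℝ] EuclideanSpace ℝ (Fin m) := L₀.symm.toLinearMap ∘ₗ p.codRestrict K hpK
  refine ⟨(K.subtype ∘ₗ L₀.toLinearMap).toContinuousLinearMap, π₀.toContinuousLinearMap,
    fun α => (L₀ α).2, fun α => ?_, ?_, fun z => ?_⟩
  · change L₀.symm (p.codRestrict K hpK (L₀ α)) = α
    rw [LinearEquiv.symm_apply_eq]
    ext
    have : φ (L₀ α) = 0 := (L₀ α).2
    simp [hp, this]
  · change L₀.symm (p.codRestrict K hpK v) = 0
    rw [LinearEquiv.symm_apply_eq, map_zero]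
    ext
    simp [hp, hv]
  · change ((L₀ (L₀.symm (p.codRestrict K hpK z)) : K) : E) = _
    rw [LinearEquiv.apply_symm_apply]
    exact hp z

/-- There is a symmetric bilinear form with a prescribed value on a nonzero vector. -/
theorem exists_symm_bilinear {α : V} {φ : V →L[ℝ] ℝ} (hφ : φ α ≠ 0) (l : V →L[ℝ] ℝ) :
    ∃ q : V →L[ℝ] V →L[ℝ] ℝ, (∀ β β', q β β' = q β' β) ∧ ∀ β, q α β = l β := by
  -- Symmetrize `l ⊗ φ / φ(α)`. The last term removes the surplus `l(α) φ(β) / φ(α)` that appears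
  -- when one argument is `α`.
  refine ⟨l.smulRight ((φ α)⁻¹ • φ) + φ.smulRight ((φ α)⁻¹ • l)
    - φ.smulRight ((l α / φ α ^ 2) • φ), fun β β' => ?_, fun β => ?_⟩
  · simp
    ring
  · simp
    field_simp
    ring

/-- The derivative of the orthogonality relation along the initial hypersurface. -/
theorem metric_cov_of_orthogonal {E P : Type*} [NormedAddCommGroup E] [NormedSpace ℝ E]
    [NormedAddCommGroup P] [NormedSpace ℝ P] {D : Set E} {G : E → E →L[ℝ] E →L[ℝ] ℝ}
    {Γ : E → E →L[ℝ] E →L[ℝ] E} {Φ : E × E → E} (hS : IsLocalSystem D G Γ Φ)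
    {O : Set (P × ℝ)} (hO : IsOpen O) {ψ : P × ℝ → E} (hψ : ContDiffOn ℝ ∞ ψ O)
    (hmaps : MapsTo ψ O D) {u : P} {t : ℝ} (hq : (u, t) ∈ O) (α : P) {B : ℝ → E} {B' : E}
    (hB : HasDerivAt B B' 0)
    (horth : ∀ᶠ s in 𝓝 (0 : ℝ),
      G (ψ (u + s • α, t)) (fderiv ℝ ψ (u + s • α, t) (0, 1)) (B s) = 0) :
    G (ψ (u, t)) (cov Γ (fun s => ψ (u, s)) (fun s => fderiv ℝ ψ (u, s) (α, 0)) t) (B 0)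
      = -G (ψ (u, t)) (fderiv ℝ ψ (u, t) (0, 1))
        (B' + Γ (ψ (u, t)) (fderiv ℝ ψ (u, t) (α, 0)) (B 0)) := by
  have hd : ∀ {f : P × ℝ → E}, ContDiffOn ℝ ∞ f O → HasFDerivAt f (fderiv ℝ f (u, t)) (u, t) :=
    fun hf => ((hf.contDiffAt (hO.mem_nhds hq)).differentiableAt (by simp)).hasFDerivAt
  have e0 : (u + (0 : ℝ) • α, t) = (u, t) := by simp
  have hV := hasDerivAt_line α (hd (contDiffOn_fderiv_apply hO hψ ((0, 1) : P × ℝ)))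
  have hx := hasDerivAt_line α (hd hψ)
  have hA := hasDerivAt_slice (hd (contDiffOn_fderiv_apply hO hψ ((α, 0) : P × ℝ)))
  -- Differentiate the orthogonality relation along the line `u + s α`: `G(∇_α V, B) + G(V, ∇_α B) =
  -- 0`. Then `∇_α V = ∇_t(∂_α ψ)`, since mixed derivatives commute and `Γ` is symmetric.
  have hm := hS.hasDerivAt_metric (x := fun s : ℝ => ψ (u + s • α, t)) (t := 0)
    (by rw [e0]; exact hmaps hq) hx hV hB
  have h0 := hm.unique ((hasDerivAt_const (0 : ℝ) (0 : ℝ)).congr_of_eventuallyEq horth)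
  rw [cov, cov, hx.deriv, hV.deriv, hB.deriv] at h0
  simp only [e0] at h0
  rw [cov, (hasDerivAt_slice (hd hψ)).deriv, hA.deriv,
    fderiv_fderiv_apply_comm (hψ.contDiffAt (hO.mem_nhds hq)),
    hS.connection_symm _ (hmaps hq) _ (fderiv ℝ ψ (u, t) (α, 0))]
  linarith

end LinearAlgebra

/-! ### Parametrized hypersurfaces in a chart -/

section Hypersurface

variable {n : ℕ} {M : Type*} [TopologicalSpace M] [ChartedSpace (EuclideanSpace ℝ (Fin n)) M]

/-- Strong normality shifts only a relatively open piece of the given hypersurface, so the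
parametrization has to be cut down to that piece. -/
theorem IsLocalParam.restrict {S : Set M} {W : Set (EuclideanSpace ℝ (Fin (n - 1)))}
    {X : EuclideanSpace ℝ (Fin (n - 1)) → M} (hX : IsLocalParam S W X) {U : Set M}
    (hU : IsOpen U) : IsLocalParam (S ∩ U) (W ∩ X ⁻¹' U) X where
  isOpen := hX.smooth.continuousOn.isOpen_inter_preimage hX.isOpen hU
  smooth := hX.smooth.mono inter_subset_left
  immersive u hu := hX.immersive u hu.1
  injOn := hX.injOn.mono inter_subset_left
  isOpen_image W' hW' hW'o := by
    obtain ⟨U', hU', h⟩ := hX.isOpen_image W' (hW'.trans inter_subset_left) hW'o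
    refine ⟨U', hU', ?_⟩
    have h2 : X '' W' ⊆ U := by
      rintro _ ⟨u, hu, rfl⟩
      exact (hW' hu).2
    ext p
    constructor
    · intro hp
      have hp' := hp
      rw [h] at hp'
      exact ⟨⟨hp'.1, h2 hp⟩, hp'.2⟩
    · rintro ⟨⟨hp, -⟩, hpU⟩
      rw [h]
      exact ⟨hp, hpU⟩

variable [IsManifold (𝓡 n) ∞ M] {e : OpenPartialHomeomorph M (EuclideanSpace ℝ (Fin n))}

/-- A section of a smooth map parametrizes a hypersurface in the domain of a chart. -/
theorem isLocalParam_symm_comp (he : e ∈ IsManifold.maximalAtlas (𝓡 n) ∞ M)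
    {ξ : EuclideanSpace ℝ (Fin (n - 1)) → EuclideanSpace ℝ (Fin n)}
    {ρ : EuclideanSpace ℝ (Fin n) → EuclideanSpace ℝ (Fin (n - 1))} (hξ : ContDiff ℝ ∞ ξ)
    (hρ : ContDiff ℝ ∞ ρ) (hρξ : ∀ u, ρ (ξ u) = u) :
    IsLocalParam ((fun u => e.symm (ξ u)) '' (ξ ⁻¹' e.target)) (ξ ⁻¹' e.target)
      (fun u => e.symm (ξ u)) where
  isOpen := e.open_target.preimage hξ.continuous
  smooth := (contMDiffOn_symm_of_mem_maximalAtlas he).comp hξ.contMDiff.contMDiffOn fun _ h => h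
  immersive u hu := by
    have hξd : DifferentiableAt ℝ ξ u := hξ.contDiffAt.differentiableAt (by simp)
    have h1 : Function.Injective (fderiv ℝ ξ u) := by
      have h2 : HasFDerivAt (fun u => ρ (ξ u)) ((fderiv ℝ ρ (ξ u)).comp (fderiv ℝ ξ u)) u :=
        HasFDerivAt.comp u (hρ.contDiffAt.differentiableAt (by simp)).hasFDerivAt hξd.hasFDerivAt
      -- Differentiating `ρ ∘ ξ = id` gives the derivative of `ξ` a left inverse.
      have h3 := h2.congr_of_eventuallyEq (f₁ := id) (.of_forall fun u => (hρξ u).symm)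
      have h4 := h3.unique (hasFDerivAt_id u)
      exact Function.LeftInverse.injective (g := fderiv ℝ ρ (ξ u)) fun a =>
        DFunLike.congr_fun h4 a
    have h5 := mfderiv_comp (I := 𝓡 (n - 1)) (I' := 𝓡 n) (I'' := 𝓡 n) u
      ((mdifferentiable_of_mem_maximalAtlas he).mdifferentiableAt_symm hu)
      hξd.mdifferentiableAt
    have h6 := (mdifferentiable_of_mem_maximalAtlas he).symm.mfderiv_injective
      (x := ξ u) hu
    rw [mfderiv_eq_fderiv] at h5
    intro a b hab
    apply h1
    apply h6
    have h7 : ∀ c, mfderiv (𝓡 (n - 1)) (𝓡 n) (fun u => e.symm (ξ u)) u c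
        = mfderiv (𝓡 n) (𝓡 n) e.symm (ξ u) (fderiv ℝ ξ u c) := fun c => DFunLike.congr_fun h5 c
    rw [h7, h7] at hab
    exact hab
  injOn u hu u' hu' h := by
    have h1 : ξ u = ξ u' := e.symm.injOn hu hu' h
    rw [← hρξ u, h1, hρξ]
  isOpen_image W' hW' hW'o := by
    -- The retraction `ρ` recovers the parameter from the point, so the image of `W'` is cut out of
    -- the hypersurface by the open condition `ρ (e p) ∈ W'`.
    refine ⟨e.source ∩ e ⁻¹' (ρ ⁻¹' W'),
      e.isOpen_inter_preimage (hW'o.preimage hρ.continuous), ?_⟩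
    ext p
    constructor
    · rintro ⟨u, hu, rfl⟩
      have hut : ξ u ∈ e.target := hW' hu
      refine ⟨⟨u, hut, rfl⟩, e.map_target hut, ?_⟩
      simpa [e.right_inv hut, hρξ] using hu
    · rintro ⟨⟨u, hut, rfl⟩, -, hu⟩
      have hut' : ξ u ∈ e.target := hut
      refine ⟨u, ?_, rfl⟩
      simpa [e.right_inv hut', hρξ] using hu

/-- The tangent vectors of a hypersurface annihilate its defining functions. -/
theorem IsTangentTo.hasFDerivAt_eq_zero (he : e ∈ IsManifold.maximalAtlas (𝓡 n) ∞ M) {S : Set M}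
    {p : M} (hp : p ∈ e.source) {w : TangentSpace (𝓡 n) p} (hw : IsTangentTo S p w)
    {h : EuclideanSpace ℝ (Fin n) → ℝ} {h' : EuclideanSpace ℝ (Fin n) →L[ℝ] ℝ}
    (hh : HasFDerivAt h h' (e p)) (hS : ∀ q ∈ S, q ∈ e.source → h (e q) = 0) :
    h' (coordOfVec e p w) = 0 := by
  obtain ⟨W, X, hX, u, hu, a, ha⟩ := hw
  obtain rfl : p = X u := congrArg (fun z : TangentBundle (𝓡 n) M => z.1) ha
  have hXd : MDifferentiableAt (𝓡 (n - 1)) (𝓡 n) X u :=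
    (hX.smooth.contMDiffAt (hX.isOpen.mem_nhds hu)).mdifferentiableAt (by simp)
  have hd : DifferentiableAt ℝ (fun u => e (X u)) u :=
    (((mdifferentiable_of_mem_maximalAtlas he).mdifferentiableAt hp).comp u hXd).differentiableAt
  have h1 := HasFDerivAt.comp (f := fun u => e (X u)) u hh hd.hasFDerivAt
  have h2 : (h ∘ fun u => e (X u)) =ᶠ[𝓝 u] fun _ => (0 : ℝ) := by
    filter_upwards [hX.isOpen.mem_nhds hu,
      hXd.continuousAt.eventually (e.open_source.mem_nhds hp)] with u' hu' hu's
    exact hS _ (hX.mem hu') hu's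
  have h3 := h1.unique ((hasFDerivAt_const (0 : ℝ) u).congr_of_eventuallyEq h2)
  rw [coordOfVec_congr ha, coordOfVec_mfderiv he hXd hp]
  exact DFunLike.congr_fun h3 a

end Hypersurface

/-! ### Quadrics with prescribed second fundamental form and the gluing of coefficients -/

section PointwiseNormality

variable {n : ℕ} {M : Type*} [TopologicalSpace M] [ChartedSpace (EuclideanSpace ℝ (Fin n)) M]
  [IsManifold (𝓡 n) ∞ M] {e : OpenPartialHomeomorph M (EuclideanSpace ℝ (Fin n))}
  {g : Bundle.ContMDiffRiemannianMetric (𝓡 n) ∞ (EuclideanSpace ℝ (Fin n))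
    (fun p : M => TangentSpace (𝓡 n) p)}
  {F : ∀ p : M, TangentSpace (𝓡 n) p → TangentSpace (𝓡 n) p}

/-- The graph of a quadratic form over the hyperplane which is the image of `L`. -/
def quadricGraph {P E : Type*} [NormedAddCommGroup P] [NormedSpace ℝ P] [NormedAddCommGroup E]
    [NormedSpace ℝ E] (y v : E) (L : P →L[ℝ] E) (q : P →L[ℝ] P →L[ℝ] ℝ) (u : P) : E :=
  y + L u + ((1 / 2 : ℝ) * q u u) • v

theorem hasFDerivAt_quadratic {P : Type*} [NormedAddCommGroup P] [NormedSpace ℝ P]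
    (q : P →L[ℝ] P →L[ℝ] ℝ) (hq : ∀ a b, q a b = q b a) (u : P) :
    HasFDerivAt (fun u => (1 / 2 : ℝ) * q u u) (q u) u := by
  have h := ((q.hasFDerivAt (x := u)).clm_apply (hasFDerivAt_id u)).const_mul (1 / 2 : ℝ)
  refine h.congr_fderiv ?_
  ext β
  simp [hq β u]
  ring

theorem hasFDerivAt_quadricGraph {P E : Type*} [NormedAddCommGroup P] [NormedSpace ℝ P]
    [NormedAddCommGroup E] [NormedSpace ℝ E] (y v : E) (L : P →L[ℝ] E) (q : P →L[ℝ] P →L[ℝ] ℝ)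
    (hq : ∀ a b, q a b = q b a) (u : P) :
    HasFDerivAt (quadricGraph y v L q) (L + (q u).smulRight v) u :=
  ((L.hasFDerivAt (x := u)).const_add y).add ((hasFDerivAt_quadratic q hq u).smul_const v)

theorem contDiff_quadricGraph {P E : Type*} [NormedAddCommGroup P] [NormedSpace ℝ P]
    [NormedAddCommGroup E] [NormedSpace ℝ E] (y v : E) (L : P →L[ℝ] E)
    (q : P →L[ℝ] P →L[ℝ] ℝ) : ContDiff ℝ ∞ (quadricGraph y v L q) :=
  (contDiff_const.add L.contDiff).add
    ((contDiff_const.mul (q.contDiff.clm_apply contDiff_id)).smul contDiff_const)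

theorem IsShift.mem_chartDomain_zero {S : Set M} {N : ∀ p : M, TangentSpace (𝓡 n) p} {ν : M → ℝ}
    {ε : ℝ} {f : M → ℝ → M} {W : Set (EuclideanSpace ℝ (Fin (n - 1)))}
    {X : EuclideanSpace ℝ (Fin (n - 1)) → M} (hf : IsShift g F S N ν ε f)
    (hX : IsLocalParam S W X) {u : EuclideanSpace ℝ (Fin (n - 1))} (hu : u ∈ W)
    (hue : X u ∈ e.source) : (u, (0 : ℝ)) ∈ IsShift.chartDomain W X ε f e :=
  ⟨⟨hu, hf.zero_mem⟩, by
    change f (X u) 0 ∈ e.source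
    rwa [hf.apply_zero (hX.mem hu)]⟩

/-- A normal shift of a hypersurface with a suitable second fundamental form realizes any Cauchy data
with `φ = φ' = 0` and nonzero vector of variation. -/
theorem StrongNormality.deviationDeriv2_eq_zero (h : StrongNormality g F)
    (hF : ContMDiff (𝓡 n).tangent (𝓡 n).tangent ∞
      (fun q : TangentBundle (𝓡 n) M => (⟨q.1, F q.1 q.2⟩ : TangentBundle (𝓡 n) M)))
    (he : e ∈ IsManifold.maximalAtlas (𝓡 n) ∞ M) {y : EuclideanSpace ℝ (Fin n)} (hy : y ∈ e.target)
    {v : EuclideanSpace ℝ (Fin n)} (hv : v ≠ 0)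
    {L : EuclideanSpace ℝ (Fin (n - 1)) →L[ℝ] EuclideanSpace ℝ (Fin n)}
    {π : EuclideanSpace ℝ (Fin n) →L[ℝ] EuclideanSpace ℝ (Fin (n - 1))}
    (hL : ∀ α, chartMetric g e y v (L α) = 0) (hπL : ∀ α, π (L α) = α) (hπv : π v = 0)
    (hLπ : ∀ z, L (π z) = z - (chartMetric g e y v z / chartMetric g e y v v) • v)
    {α : EuclideanSpace ℝ (Fin (n - 1))} (hα : α ≠ 0) {w : EuclideanSpace ℝ (Fin n)}
    (hw : deviationDeriv (chartMetric g e) (chartForce F e) y v (L α) w = 0) :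
    deviationDeriv2 (chartMetric g e) (chartConnection g e) (chartForce F e) y v (L α) w = 0 := by
  have hS := isLocalSystem_chart g F he hF
  set G := chartMetric g e with hG
  set Γ := chartConnection g e with hΓ
  have hvv : 0 < G y v v := hS.metric_pos y hy v hv
  -- the second fundamental form
  obtain ⟨q, hq, hqα⟩ := exists_symm_bilinear (α := α) (φ := innerSL ℝ α) (by simpa using hα)
    -- Solved from the requirement `G(w, L β) = -q(α, β) G(v, v) - G(v, Γ(L α, L β))`, which is what
    -- the differentiated orthogonality will say about `∇_t τ` in place of `w`.
    ((-(G y v v)⁻¹) • ((G y w + (G y v).comp (Γ y (L α))).comp L))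
  set ξ := quadricGraph y v L q with hξ
  have hξ0 : ξ 0 = y := by simp [hξ, quadricGraph]
  have hξc : ContDiff ℝ ∞ ξ := contDiff_quadricGraph y v L q
  have hξd : ∀ u, HasFDerivAt ξ (L + (q u).smulRight v) u := hasFDerivAt_quadricGraph y v L q hq
  have hρξ : ∀ u, π (ξ u - y) = u := fun u => by simp [hξ, quadricGraph, add_assoc, hπL, hπv]
  have hρc : ContDiff ℝ ∞ fun z => π (z - y) := π.contDiff.comp (contDiff_id.sub contDiff_const)
  have hX := isLocalParam_symm_comp he hξc hρc hρξ
  set X : EuclideanSpace ℝ (Fin (n - 1)) → M := fun u => e.symm (ξ u) with hXdef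
  set S : Set M := X '' (ξ ⁻¹' e.target) with hSdef
  have hX0 : X 0 = e.symm y := by rw [hXdef]; simp only [hξ0]
  have h0W : (0 : EuclideanSpace ℝ (Fin (n - 1))) ∈ ξ ⁻¹' e.target := by
    rw [mem_preimage, hξ0]; exact hy
  have hp0 : e.symm y ∈ S := ⟨0, h0W, hX0⟩
  -- the unit normal vector
  set c := Real.sqrt (G y v v) with hc
  have hc0 : c ≠ 0 := (Real.sqrt_pos.2 hvv).ne'
  have hcc : c * c = G y v v := Real.mul_self_sqrt hvv.le
  have hunit : IsUnitNormalAt g S (e.symm y) (vecOfCoord e y (c⁻¹ • v)) := by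
    constructor
    · rw [← chartMetric_eq_inner, map_smul, map_smul, smul_apply, smul_eq_mul, smul_eq_mul]
      change c⁻¹ * (c⁻¹ * G y v v) = 1
      rw [← hcc]
      field_simp
    · intro a ha
      -- A defining function of the quadric, with the metric frozen at `y`. Its quadratic part has
      -- zero derivative at `y`, so tangent vectors there are those orthogonal to `v`.
      have h1 := ha.hasFDerivAt_eq_zero he (e.map_target hy)
        (h := fun z => G y v (z - y) - (1 / 2 : ℝ) * q (π (z - y)) (π (z - y)) * G y v v)
        (h' := G y v) ?_ ?_
      · rw [inner_eq_chartMetric g he (e.map_target hy), e.right_inv hy, coordOfVec_vecOfCoord he hy,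
          map_smul, smul_apply]
        exact (congrArg (c⁻¹ • ·) h1).trans (smul_zero _)
      · rw [e.right_inv hy]
        have h2 : HasFDerivAt (fun z => z - y)
            (ContinuousLinearMap.id ℝ (EuclideanSpace ℝ (Fin n))) y :=
          (hasFDerivAt_id y).sub_const y
        have hπ := HasFDerivAt.comp (f := fun z => z - y) y (π.hasFDerivAt (x := y - y)) h2
        have h3 := HasFDerivAt.comp (f := fun z => π (z - y)) y
          (hasFDerivAt_quadratic q hq (π (y - y))) hπ
        have h4 := (HasFDerivAt.comp (f := fun z => z - y) y
          ((G y v).hasFDerivAt (x := y - y)) h2).sub (h3.mul_const (G y v v))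
        refine h4.congr_fderiv ?_
        ext z
        simp
      · rintro _ ⟨u, hu, rfl⟩ -
        have hut : ξ u ∈ e.target := hu
        have h5 : e (X u) = ξ u := e.right_inv hut
        simp only [h5, hρξ]
        simp [hξ, quadricGraph, add_assoc, hL]
  -- the normal shift
  obtain ⟨S', ⟨U, hU, hS'⟩, hpS', -, N, hN, hNp, ν, -, hνp, ε, f, hf, hnorm⟩ :=
    h S (fun p hp => ⟨_, _, hX, hp⟩) _ hp0 _ hunit c hc0
  subst hS'
  have hX' := hX.restrict hU
  set W := ξ ⁻¹' e.target ∩ X ⁻¹' U with hW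
  have h0W' : (0 : EuclideanSpace ℝ (Fin (n - 1))) ∈ W :=
    ⟨h0W, by rw [mem_preimage, hX0]; exact hpS'.2⟩
  have hO := hf.isOpen_chartDomain hX' e
  have hψ := hf.contDiffOn_chart hX' he
  set O := IsShift.chartDomain W X ε f e with hOdef
  set ψ : EuclideanSpace ℝ (Fin (n - 1)) × ℝ → EuclideanSpace ℝ (Fin n) :=
    fun q => e (f (X q.1) q.2) with hψdef
  have hmaps : MapsTo ψ O e.target := fun z hz => e.map_source hz.2
  have hOmem : ∀ u ∈ W, (u, (0 : ℝ)) ∈ O := fun u hu =>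
    hf.mem_chartDomain_zero hX' hu (e.map_target hu.1)
  have hψ0 : ∀ u ∈ W, ψ (u, 0) = ξ u := fun u hu => by
    simp only [hψdef, hf.apply_zero (hX'.mem hu)]
    exact e.right_inv hu.1
  have hψy : ψ (0, 0) = y := (hψ0 0 h0W').trans hξ0
  have hψd : ∀ z ∈ O, HasFDerivAt ψ (fderiv ℝ ψ z) z := fun z hz =>
    ((hψ.contDiffAt (hO.mem_nhds hz)).differentiableAt (by simp)).hasFDerivAt
  have hψdu : ∀ u ∈ W, ∀ β, fderiv ℝ ψ (u, 0) (β, 0) = L β + q u β • v := by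
    intro u hu β
    have h1 := HasFDerivAt.comp (f := fun u' : EuclideanSpace ℝ (Fin (n - 1)) => (u', (0 : ℝ))) u
      (hψd _ (hOmem u hu)) (hasFDerivAt_prodMk_left u 0)
    have h2 : (ψ ∘ fun u' => (u', (0 : ℝ))) =ᶠ[𝓝 u] ξ := by
      filter_upwards [hX'.isOpen.mem_nhds hu] with u' hu' using hψ0 u' hu'
    exact DFunLike.congr_fun (h1.unique ((hξd u).congr_of_eventuallyEq h2)) β
  have hψdt : ∀ z ∈ O, deriv (fun s => e (f (X z.1) s)) z.2 = fderiv ℝ ψ z (0, 1) := fun z hz =>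
    (hasDerivAt_slice (hψd z hz)).deriv
  have h00 : ((0 : EuclideanSpace ℝ (Fin (n - 1))), (0 : ℝ)) ∈ O := hOmem 0 h0W'
  have htraj := hf.trajectory _ (hX'.mem h0W')
  -- The unit normal is `c⁻¹ v` and the prescribed value of `ν` is `c = |v|`, so the central
  -- trajectory starts with velocity exactly `v`.
  have hv0 : fderiv ℝ ψ (0, 0) (0, 1) = v := by
    rw [← hψdt _ h00, ← coordOfVec_velocity he (htraj.mdifferentiableAt hf.zero_mem) h00.2,
      coordOfVec_congr (hf.initial _ (hX'.mem h0W')), hX0, hνp, hNp]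
    rw [show coordOfVec e (e.symm y) (c • vecOfCoord e y (c⁻¹ • v))
      = c • coordOfVec e (e.symm y) (vecOfCoord e y (c⁻¹ • v)) from map_smul _ _ _,
      coordOfVec_vecOfCoord he hy, smul_inv_smul₀ hc0]
  -- the functions of deviation
  have hvar := hf.isVariation hX' hF h0W' α
  have hder := hvar.hasDerivAt_deviation htraj he hF ⟨hf.zero_mem, h00.2⟩
  have hdev0 : ∀ t ∈ Ioo (-ε) ε, deviation g (f (X 0)) (shiftVariationAlong f X 0 α) t = 0 :=
    fun t ht => hnorm.deviation_eq_zero hX' h0W' α ht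
  have hev : deviation g (f (X 0)) (shiftVariationAlong f X 0 α) =ᶠ[𝓝 0] fun _ => (0 : ℝ) := by
    filter_upwards [isOpen_Ioo.mem_nhds hf.zero_mem] with t ht using hdev0 t ht
  have hev' : deriv (deviation g (f (X 0)) (shiftVariationAlong f X 0 α)) =ᶠ[𝓝 0]
      fun _ => (0 : ℝ) := by
    refine hev.deriv.trans (.of_eq ?_)
    funext t
    exact deriv_const _ _
  have hd1 := hder.1.unique ((hasDerivAt_const (0 : ℝ) (0 : ℝ)).congr_of_eventuallyEq hev)
  have hd2 := hder.2.unique ((hasDerivAt_const (0 : ℝ) (0 : ℝ)).congr_of_eventuallyEq hev')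
  have hTeq : (fun s => coordOfVec e (f (X 0) s) (shiftVariationAlong f X 0 α s)) =ᶠ[𝓝 0]
      fun s => fderiv ℝ ψ (0, s) (α, 0) := by
    filter_upwards [eventually_slice hO h00] with s hs
    exact hf.coordOfVec_shiftVariationAlong hX' he hs α
  have hT0 : fderiv ℝ ψ (0, 0) (α, 0) = L α := by rw [hψdu 0 h0W']; simp
  have hcov : cov Γ (fun s => e (f (X 0) s))
      (fun s => coordOfVec e (f (X 0) s) (shiftVariationAlong f X 0 α s)) 0
      = cov Γ (fun s => ψ (0, s)) (fun s => fderiv ℝ ψ (0, s) (α, 0)) 0 := by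
    rw [cov, cov, hTeq.deriv_eq, hTeq.eq_of_nhds]
  set Dw := cov Γ (fun s => ψ (0, s)) (fun s => fderiv ℝ ψ (0, s) (α, 0)) 0 with hDw
  have hx0 : e (f (X 0) 0) = y := hψy
  rw [hcov, hTeq.eq_of_nhds, hψdt _ h00, hv0, hT0, hx0] at hd1 hd2
  -- the covariant derivative of the vector of variation
  have htan : ∀ β, G y Dw (L β) = G y w (L β) := by
    intro β
    -- `L β + s q(α, β) v` is the coordinate tangent vector of the quadric in the direction `β` at
    -- the parameter `s α`.
    have hB : HasDerivAt (fun s : ℝ => L β + (s * q α β) • v) (q α β • v) 0 := by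
      have := (((hasDerivAt_id (0 : ℝ)).mul_const (q α β)).smul_const v).const_add (L β)
      simpa using this
    have hlineW : ∀ᶠ s in 𝓝 (0 : ℝ), (0 : EuclideanSpace ℝ (Fin (n - 1))) + s • α ∈ W :=
      (by fun_prop : Continuous fun s : ℝ =>
        (0 : EuclideanSpace ℝ (Fin (n - 1))) + s • α).continuousAt.eventually
        (hX'.isOpen.mem_nhds (by simpa using h0W'))
    have horth : ∀ᶠ s in 𝓝 (0 : ℝ), G (ψ (0 + s • α, 0)) (fderiv ℝ ψ (0 + s • α, 0) (0, 1))
        (L β + (s * q α β) • v) = 0 := by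
      filter_upwards [hlineW] with s hs
      have hmem := hOmem _ hs
      have h1 := hnorm.deviation_eq_zero hX' hs β hf.zero_mem
      rw [(hf.trajectory _ (hX'.mem hs)).deviation_eq he _ ⟨hf.zero_mem, hmem.2⟩,
        hf.coordOfVec_shiftVariationAlong hX' he hmem, hψdt _ hmem] at h1
      refine Eq.trans ?_ h1
      change _ = G _ _ (fderiv ℝ ψ (0 + s • α, 0) (β, 0))
      rw [hψdu _ hs, show q (0 + s • α) β = s * q α β by simp]
    -- Only normality at `t = 0`, at the parameters `s α` near the origin, is used here; the choice
    -- of `q` turns the right-hand side into `G(w, L β)`.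
    have h2 := metric_cov_of_orthogonal hS hO hψ hmaps h00 α hB horth
    rw [hψy, hv0, hT0, ← hDw] at h2
    simp only [zero_mul, zero_smul, add_zero, map_add, map_smul, smul_eq_mul, hqα] at h2
    rw [h2]
    simp
    field_simp
    ring
  -- The components tangent to the hyperplane agree by `htan`, and those along `v` agree because
  -- both data satisfy `φ' = 0` with the same `T`.
  have hDww : Dw = w := by
    have hnor : G y v Dw = G y v w := by
      have e1 : G y (chartForce F e (y, v)) (L α) + G y v Dw = 0 := hd1
      have e2 : G y (chartForce F e (y, v)) (L α) + G y v w = 0 := hw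
      linarith
    have hall : ∀ z, G y (Dw - w) z = 0 := by
      intro z
      have hz : z = L (π z) + (G y v z / G y v v) • v := by rw [hLπ z]; simp
      rw [hz, map_add, map_smul, map_sub, sub_apply, sub_apply, htan,
        hS.metric_symm y hy Dw v, hS.metric_symm y hy w v, hnor]
      simp
    by_contra hne
    exact (hS.metric_pos y hy (Dw - w) (sub_ne_zero.2 hne)).ne' (hall _)
  rw [hDww] at hd2
  exact hd2

/-- The condition `φ = 0` says that `T` lies in the hyperplane orthogonal to `v`, so `T = L (π T)`,
and the quadric construction covers every `T ≠ 0`. -/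
theorem StrongNormality.isPointwiseNormal (h : StrongNormality g F) (hn : 2 ≤ n)
    (hF : ContMDiff (𝓡 n).tangent (𝓡 n).tangent ∞
      (fun q : TangentBundle (𝓡 n) M => (⟨q.1, F q.1 q.2⟩ : TangentBundle (𝓡 n) M)))
    (he : e ∈ IsManifold.maximalAtlas (𝓡 n) ∞ M) :
    IsPointwiseNormal e.target (chartMetric g e) (chartConnection g e) (chartForce F e) := by
  intro y hy v hv T w hT hw
  have hvv : chartMetric g e y v v ≠ 0 := (chartMetric_pos g he hy hv).ne'
  obtain ⟨L, π, hL, hπL, hπv, hLπ⟩ := exists_hyperplane_param (m := n - 1)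
    (by rw [finrank_euclideanSpace_fin]; omega) (chartMetric g e y v) hvv
  have key : ∀ α : EuclideanSpace ℝ (Fin (n - 1)), α ≠ 0 → ∀ w,
      deviationDeriv (chartMetric g e) (chartForce F e) y v (L α) w = 0 →
      deviationDeriv2 (chartMetric g e) (chartConnection g e) (chartForce F e) y v (L α) w = 0 :=
    fun α hα w hw => h.deviationDeriv2_eq_zero hF he hy hv hL hπL hπv hLπ hα hw
  have hTL : L (π T) = T := by rw [hLπ, hT]; simp
  by_cases hT0 : π T = 0
  -- For `T = 0` the data `(0, w)` is the difference of `(L α, -a v + w)` and `(L α, -a v)`, where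
  -- `a` is chosen so that both have `φ' = 0`. A nonzero `α` exists because `n ≥ 2`.
  · obtain ⟨α, hα⟩ : ∃ α : EuclideanSpace ℝ (Fin (n - 1)), α ≠ 0 := by
      have : Nonempty (Fin (n - 1)) := ⟨⟨0, by omega⟩⟩
      exact exists_ne 0
    have hT00 : T = 0 := by rw [← hTL, hT0, map_zero]
    subst hT00
    set a := chartMetric g e y (chartForce F e (y, v)) (L α) / chartMetric g e y v v with ha
    have h1 : deviationDeriv (chartMetric g e) (chartForce F e) y v (L α) ((-a) • v) = 0 := by
      rw [deviationDeriv, map_smul, smul_eq_mul, ha, neg_mul, div_mul_cancel₀ _ hvv,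
        add_neg_cancel]
    have h2 : deviationDeriv (chartMetric g e) (chartForce F e) y v
        (L α + (1 : ℝ) • 0) ((-a) • v + (1 : ℝ) • w) = 0 := by
      rw [deviationDeriv_add_smul, h1, hw]
      simp
    have h3 := key α hα ((-a) • v + (1 : ℝ) • w) (by simpa using h2)
    have h4 := deviationDeriv2_add_smul (G := chartMetric g e) (Γ := chartConnection g e)
      (Φ := chartForce F e) y v (L α) 0 ((-a) • v) w 1
    rw [key α hα _ h1] at h4
    simp only [smul_zero, add_zero, zero_add, one_mul] at h4
    rw [← h4]
    exact h3
  · rw [← hTL] at hw ⊢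
    exact key _ hT0 w hw

/-- Pointwise normality gives coefficients in every chart, but they have `G(v, v)` in the
denominator and depend on local choices. A continuous global selection comes from convexity of the
sets `K t` of admissible pairs. -/
theorem StrongNormality.weakNormality (h : StrongNormality g F) (hn : 2 ≤ n)
    (hF : ContMDiff (𝓡 n).tangent (𝓡 n).tangent ∞
      (fun q : TangentBundle (𝓡 n) M => (⟨q.1, F q.1 q.2⟩ : TangentBundle (𝓡 n) M))) :
    WeakNormality g F := by
  intro J γ hγ
  let K : J → Set (ℝ × ℝ) := fun t =>
    {c | ∀ τ : (∀ t, TangentSpace (𝓡 n) (γ t)), IsVariation g F J γ τ →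
      deriv (deriv (deviation g γ τ)) t
        = c.1 * deriv (deviation g γ τ) t + c.2 * deviation g γ τ t}
  -- For a fixed vector of variation, the equation at `t` is affine in the pair of coefficients.
  have hconvex : ∀ t, Convex ℝ (K t) := by
    intro t a ha b hb r s hr hs hrs τ hτ
    have h1 := ha τ hτ
    have h2 := hb τ hτ
    set φ₂ := deriv (deriv (deviation g γ τ)) t
    calc φ₂ = r * φ₂ + s * φ₂ := by rw [← add_mul, hrs, one_mul]
      _ = r * (a.1 * deriv (deviation g γ τ) t + a.2 * deviation g γ τ t)
          + s * (b.1 * deriv (deviation g γ τ) t + b.2 * deviation g γ τ t) := by rw [← h1, ← h2]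
      _ = _ := by
        simp
        ring
  have hlocal : ∀ t₀ : J, ∃ U ∈ 𝓝 t₀, ∃ c : J → ℝ × ℝ, ContinuousOn c U ∧ ∀ t ∈ U,
      c t ∈ K t := by
    rintro ⟨t₀, ht₀⟩
    set e := chartAt (EuclideanSpace ℝ (Fin n)) (γ t₀)
    have he : e ∈ IsManifold.maximalAtlas (𝓡 n) ∞ M := IsManifold.chart_mem_maximalAtlas _
    have hS := isLocalSystem_chart g F he hF
    have hN := h.isPointwiseNormal hn hF he
    have hI := hγ.isOpen_chart e
    have ht₀I : t₀ ∈ J ∩ γ ⁻¹' e.source := ⟨ht₀, mem_chart_source _ _⟩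
    have hx := hγ.contDiffOn_chart he
    have hx' : ContDiffOn ℝ ∞ (deriv fun s => e (γ s)) (J ∩ γ ⁻¹' e.source) :=
      hx.deriv_of_isOpen hI (by simp)
    -- At an instant of zero velocity the trajectory is constant nearby, every function of deviation
    -- is locally zero, and the pair `(0, 0)` is admissible. Elsewhere `v ≠ 0` on a neighbourhood,
    -- and the explicit coefficients are continuous there.
    by_cases hv : deriv (fun s => e (γ s)) t₀ = 0
    · have hz := hS.eventually_velocity_eq_zero
        (fun y hy => hN.force_zero hS (by rwa [finrank_euclideanSpace_fin]) hy) hI hx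
        (IsTrajectory.mapsTo_chart e γ) (fun s hs => hγ.newton_chart he hs) ht₀I hv
      obtain ⟨U, hUI, hU, htU⟩ := mem_nhds_iff.1 (hz.and (hI.mem_nhds ht₀I))
      refine ⟨Subtype.val ⁻¹' U, (hU.preimage continuous_subtype_val).mem_nhds htU, fun _ => 0,
        continuousOn_const, fun t ht τ hτ => ?_⟩
      have h0 : deviation g γ τ =ᶠ[𝓝 t.1] fun _ => (0 : ℝ) := by
        filter_upwards [hU.mem_nhds ht] with s hs
        rw [hγ.deviation_eq he τ (hUI hs).2, (hUI hs).1]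
        simp
      have h1 := h0.deriv
      rw [h1.deriv_eq]
      simp
    · have hcv : ContinuousAt (deriv fun s => e (γ s)) t₀ :=
        hx'.continuousOn.continuousAt (hI.mem_nhds ht₀I)
      obtain ⟨U, hUI, hU, htU⟩ := mem_nhds_iff.1
        ((hcv.eventually_ne hv).and (hI.mem_nhds ht₀I))
      refine ⟨Subtype.val ⁻¹' U, (hU.preimage continuous_subtype_val).mem_nhds htU, fun t =>
        (normalCoeffA (chartMetric g e) (chartConnection g e) (chartForce F e) (e (γ t))
          (deriv (fun s => e (γ s)) t),
        normalCoeffB (chartMetric g e) (chartConnection g e) (chartForce F e) (e (γ t))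
          (deriv (fun s => e (γ s)) t)), ?_, fun t ht τ hτ => ?_⟩
      · intro t ht
        have hc := hS.continuousAt_normalCoeff (y := fun s => e (γ s)) (e.map_source (hUI ht).2.2)
          (hUI ht).1 (hx.continuousOn.continuousAt (hI.mem_nhds (hUI ht).2))
          (hx'.continuousOn.continuousAt (hI.mem_nhds (hUI ht).2))
        exact (ContinuousAt.comp (f := Subtype.val) (hc.1.prodMk hc.2)
          continuous_subtype_val.continuousAt).continuousWithinAt
      · have hd := hτ.hasDerivAt_deviation hγ he hF (hUI ht).2
        rw [hd.1.deriv, hd.2.deriv, hγ.deviation_eq he τ (hUI ht).2]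
        exact hN.deviationDeriv2_eq hS (e.map_source (hUI ht).2.2) (hUI ht).1 _ _
  obtain ⟨c, hc⟩ := exists_continuous_forall_mem_convex_of_local hconvex hlocal
  classical
  -- The value `0` outside `J` is irrelevant: continuity and the equation are required only on `J`.
  refine ⟨fun t => if ht : t ∈ J then (c ⟨t, ht⟩).1 else 0,
    fun t => if ht : t ∈ J then (c ⟨t, ht⟩).2 else 0, ?_, ?_, fun τ hτ t ht => ?_⟩
  · rw [continuousOn_iff_continuous_domRestrict]
    convert continuous_fst.comp c.continuous using 1
    funext t
    simp [t.2]
  · rw [continuousOn_iff_continuous_domRestrict]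
    convert continuous_snd.comp c.continuous using 1
    funext t
    simp [t.2]
  · simpa [ht] using hc ⟨t, ht⟩ τ hτ

end PointwiseNormality

end NewtonianShift

end

theorem theorem12p1 {n : ℕ} (hn : 2 ≤ n) {M : Type*} [TopologicalSpace M] [T2Space M]
    [ChartedSpace (EuclideanSpace ℝ (Fin n)) M] [IsManifold (𝓡 n) ∞ M]
    (g : Bundle.ContMDiffRiemannianMetric (𝓡 n) ∞ (EuclideanSpace ℝ (Fin n))
      (fun p : M => TangentSpace (𝓡 n) p))
    (F : ∀ p : M, TangentSpace (𝓡 n) p → TangentSpace (𝓡 n) p)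
    (hF : ContMDiff (𝓡 n).tangent (𝓡 n).tangent ∞
      (fun q : TangentBundle (𝓡 n) M => (⟨q.1, F q.1 q.2⟩ : TangentBundle (𝓡 n) M))) :
    NewtonianShift.CompleteNormality g F ↔ NewtonianShift.StrongNormality g F := by
  exact ⟨fun h => h.strongNormality hF, fun h => ⟨h.weakNormality hn hF, h.additionalNormality⟩⟩
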